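/- **Setting.** Consider finite $n$-player extensive-form games with perfect recall: a finite tree of histories $H$ with terminal histories $Z$; each nonterminal history belongs to chance (which plays a fixed distribution over the available actions) or to a player $i$; the histories of each player are partitioned into information sets, all histories in an information set $I$ having the same action set $A_I$; each player has a utility $u_i$ on $Z$; and all histories in an information set of $i$ share the same sequence of earlier information sets and actions of $i$. A pure strategy $x_i\in X_i$ picks an action of $A_I$ at every information set $I$ of $i$. A correlated profile is a distribution $\pi\in\Delta(X_1\times\dots\times X_n)$. Two correlated profiles are *outcome-equivalent* if they induce the same distribution on $Z$. Write $x_i(Ia)=1$ if $x_i$ plays all of $i$'s actions on the way to $I$ and plays $a$ at $I$, and $x_i(Ia)=0$ otherwise. A map $\phi:X_i\to X_i$ is a *causal deviation* if, for every $I$, the action $\phi(x_i)(I)$ depends only on $I$ and on the values $x_i(Ja)$ with $J\preceq I$, $a\in A_J$ (where $J\preceq I$ means that some history in $I$ equals or passes through a history in $J$). The profile $\pi$ is an *$\varepsilon$-EFCE* if $\mathbb E_{x\sim\pi}[u_i(\phi(x_i),x_{-i})-u_i(x)]\le\varepsilon$ for every player $i$ and every causal deviation $\phi$ of $i$. All numbers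 in the input (utilities, chance probabilities, probabilities describing the profile, and the integer names of actions and information sets) are integers, or rationals given as fractions of integers, of polynomial bit length, and the number of players is polynomial; running time is counted on a deterministic machine that is charged for every symbol (bit) it reads, copies or writes. **Lemma.** There is an algorithm with the following property. Its input is such a game together with an $\varepsilon$-EFCE $$\pi=\sum_{t=1}^{T}\alpha^{(t)}\bigotimes_{i=1}^n\pi^{(t)}_i ,$$ where $\alpha^{(t)}\ge 0$, $\sum_t\alpha^{(t)}=1$ and each $\pi_i^{(t)}$ is a behavior strategy (the actions at the different information sets of $i$ are independent), given by its action probabilities at each information set. Its output is a correlated profile $$\pi'=\sum_{t=1}^{T}\tilde\alpha^{(t)}\bigotimes_{i=1}^n\ \sum_{k=1}^{K}\beta_i^{(t,k)}x_i^{(t,k)},\qquad 1\le K\le |H| ,$$ with the same number $T$ of products, where $\tilde\alpha^{(t)},\beta_i^{(t,k)}\ge 0$ are rational numbers given as fractions, $\sum_t\tilde\alpha^{(t)}=1$, $\sum_k\beta_i^{(t,k)}=1$ for all $i,t$, and the $x_i^{(t,k)}\in X_i$ are pure strategies, such that $\pi'$ is an $\varepsilon$-EFCE and is outcome-equivalent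 to $\pi$. The running time is $\mathrm{poly}(|H|,T)$: for every polynomial $q$ there is a polynomial $p$ such that, whenever $n$ and the bit lengths of all integers in the input are at most $q(|H|+T)$, the algorithm halts after at most $p(|H|+T)$ steps. -/

import Mathlib

open Finset

/-! ### Machine model

Programs act on finite trees whose atoms are integers written in binary. Every step is charged the
number of symbols of the data it reads, copies and writes, so the charged time is polynomially
related to the running time of a multitape Turing machine. -/

/-- Data: integers, the empty list, and ordered pairs. -/
inductive Val where
  | int (z : ℤ)
  | nil
  | cons (a b : Val)
  deriving DecidableEq

namespace Val

/-- Number of symbols needed to write a value (integers in binary). -/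
def size : Val → ℕ
  | int z => 1 + Nat.size z.natAbs
  | nil => 1
  | cons a b => 1 + a.size + b.size

/-- The largest bit length of an integer that occurs in a value. -/
def maxBits : Val → ℕ
  | int z => Nat.size z.natAbs
  | nil => 0
  | cons a b => max a.maxBits b.maxBits

/-- First component (`nil` if there is none). -/
def hd : Val → Val
  | cons a _ => a
  | _ => nil

/-- Second component (`nil` if there is none). -/
def tl : Val → Val
  | cons _ b => b
  | _ => nil

/-- The integer held by an atom (`0` for other values). -/
def toInt : Val → ℤ
  | int z => z
  | _ => 0

/-- Truth values: `nil` is false, and `int 1` is the true value returned by tests. -/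
def ofBool : Bool → Val
  | true => int 1
  | false => nil

/-- Test for being a pair. -/
def isCons : Val → Bool
  | cons _ _ => true
  | _ => false

/-- Test for being an integer. -/
def isInt : Val → Bool
  | int _ => true
  | _ => false

/-- A list of values as a value. -/
def ofList : List Val → Val
  | [] => nil
  | v :: l => cons v (ofList l)

/-- A finite family of values, listed in increasing order of the index. -/
def ofFamily {α : Type} [Fintype α] [LinearOrder α] (f : α → Val) : Val :=
  ofList (((Finset.univ : Finset α).sort (· ≤ ·)).map f)

/-- A natural number as a value. -/
def ofNat (m : ℕ) : Val := int m

end Val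

/-- Elementary operations. Binary operations act on the two components of a pair. -/
inductive Op where
  | id
  | const (v : Val)
  | hd
  | tl
  | isCons
  | isInt
  | eq
  | lt
  | add
  | sub
  | mul

/-- The result of an elementary operation. -/
def Op.eval : Op → Val → Val
  | .id, v => v
  | .const w, _ => w
  | .hd, v => v.hd
  | .tl, v => v.tl
  | .isCons, v => Val.ofBool v.isCons
  | .isInt, v => Val.ofBool v.isInt
  | .eq, v => Val.ofBool (decide (v.hd = v.tl))
  | .lt, v => Val.ofBool (decide (v.hd.toInt < v.tl.toInt))
  | .add, v => .int (v.hd.toInt + v.tl.toInt)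
  | .sub, v => .int (v.hd.toInt - v.tl.toInt)
  | .mul, v => .int (v.hd.toInt * v.tl.toInt)

/-- Programs: elementary operations, sequencing (`seq f g` runs `f`, then `g` on the result),
pairing, branching, and while-loops. -/
inductive Prog where
  | op (o : Op)
  | seq (f g : Prog)
  | pair (f g : Prog)
  | ite (c f g : Prog)
  | loop (c f : Prog)

/-- `Prog.Run f v w t`: on input `v` the program `f` halts with output `w` after time `t`. -/
inductive Prog.Run : Prog → Val → Val → ℕ → Prop
  | op (o : Op) (v : Val) :
      Prog.Run (.op o) v (o.eval v) (1 + v.size + (o.eval v).size)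
  | seq {f g : Prog} {v w u : Val} {s t : ℕ} :
      Prog.Run f v w s → Prog.Run g w u t → Prog.Run (.seq f g) v u (1 + s + t)
  | pair {f g : Prog} {v w u : Val} {s t : ℕ} :
      Prog.Run f v w s → Prog.Run g v u t →
        Prog.Run (.pair f g) v (.cons w u) (1 + v.size + s + t)
  | iteTrue {c f g : Prog} {v b w : Val} {s t : ℕ} :
      Prog.Run c v b s → b ≠ .nil → Prog.Run f v w t →
        Prog.Run (.ite c f g) v w (1 + v.size + s + t)
  | iteFalse {c f g : Prog} {v w : Val} {s t : ℕ} :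
      Prog.Run c v .nil s → Prog.Run g v w t →
        Prog.Run (.ite c f g) v w (1 + v.size + s + t)
  | loopDone {c f : Prog} {v : Val} {s : ℕ} :
      Prog.Run c v .nil s → Prog.Run (.loop c f) v v (1 + v.size + s)
  | loopNext {c f : Prog} {v b w u : Val} {s t r : ℕ} :
      Prog.Run c v b s → b ≠ .nil → Prog.Run f v w t → Prog.Run (.loop c f) w u r →
        Prog.Run (.loop c f) v u (1 + v.size + s + t + r)

/-! ### Extensive-form games -/

/-- A fraction, not necessarily in lowest terms. -/
structure Frac where
  num : ℤ
  den : ℕ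
  den_pos : 0 < den

/-- The value of a fraction. -/
noncomputable def Frac.val (q : Frac) : ℝ := (q.num : ℝ) / (q.den : ℝ)

/-- The data of an `n`-player extensive-form game. A history is the list of the actions taken
since the root, which is the empty list. `owner h` is the acting player (`none` for chance) and
`infoset h` the name of the acting player's information set; both matter at nonterminal histories
only. -/
structure GameForm (n : ℕ) where
  hist : Finset (List ℕ)
  owner : List ℕ → Option (Fin n)
  infoset : List ℕ → ℕ
  chanceProb : List ℕ → ℕ → Frac
  util : Fin n → List ℕ → Frac

namespace GameForm

variable {n : ℕ} (G : GameForm n)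

/-- The actions available at a history. -/
def actions (h : List ℕ) : Finset ℕ :=
  (G.hist.biUnion List.toFinset).filter (fun a => h ++ [a] ∈ G.hist)

theorem mem_actions (h : List ℕ) (a : ℕ) : a ∈ G.actions h ↔ h ++ [a] ∈ G.hist := by
  simp only [actions, Finset.mem_filter, Finset.mem_biUnion, List.mem_toFinset,
    and_iff_right_iff_imp]
  intro hm
  exact ⟨_, hm, by simp⟩

/-- Terminal histories. -/
def terminals : Finset (List ℕ) := G.hist.filter (fun h => G.actions h = ∅)

/-- The nonterminal histories at which player `i` acts. -/
def nodes (i : Fin n) : Finset (List ℕ) :=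
  G.hist.filter (fun h => G.actions h ≠ ∅ ∧ G.owner h = some i)

/-- The names of the information sets of player `i`. -/
def infosets (i : Fin n) : Finset ℕ := (G.nodes i).image G.infoset

/-- The histories in the information set of player `i` named `I`. -/
def infosetNodes (i : Fin n) (I : ℕ) : Finset (List ℕ) :=
  (G.nodes i).filter (fun h => G.infoset h = I)

/-- The actions available at the information set of player `i` named `I`. -/
def infosetActions (i : Fin n) (I : ℕ) : Finset ℕ := (G.infosetNodes i I).biUnion G.actions

/-- The sequence of player `i` at `h`: the information sets at which `i` acted strictly before `h`,
with the actions that `i` took there. -/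
def sequence (i : Fin n) (h : List ℕ) : List (ℕ × ℕ) :=
  (List.finRange h.length).filterMap fun (k : Fin h.length) =>
    if G.owner (h.take k) = some i then some (G.infoset (h.take k), h.get k) else none

end GameForm

/-- An `n`-player extensive-form game with perfect recall. -/
structure Game (n : ℕ) extends GameForm n where
  root_mem : [] ∈ hist
  parent_mem : ∀ h a, h ++ [a] ∈ hist → h ∈ hist
  same_actions : ∀ i, ∀ g ∈ toGameForm.nodes i, ∀ h ∈ toGameForm.nodes i,
    infoset g = infoset h → toGameForm.actions g = toGameForm.actions h
  chance_nonneg : ∀ h ∈ hist, owner h = none → ∀ a ∈ toGameForm.actions h,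
    0 ≤ (chanceProb h a).val
  chance_sum : ∀ h ∈ hist, owner h = none → toGameForm.actions h ≠ ∅ →
    ∑ a ∈ toGameForm.actions h, (chanceProb h a).val = 1
  perfect_recall : ∀ i, ∀ g ∈ toGameForm.nodes i, ∀ h ∈ toGameForm.nodes i,
    infoset g = infoset h → toGameForm.sequence i g = toGameForm.sequence i h

namespace Game

variable {n : ℕ} (G : Game n)

/-- Pure strategies of player `i`. -/
abbrev Pure (i : Fin n) : Type := (I : G.infosets i) → G.infosetActions i (I : ℕ)

/-- Pure strategy profiles. -/
abbrev Profile : Type := (i : Fin n) → G.Pure i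

/-- Player `i` plays, under `x`, all its actions on the path from the root to `h`. -/
def Reaches {i : Fin n} (x : G.Pure i) (h : List ℕ) : Prop :=
  ∀ I : G.infosets i, ∀ g ∈ G.infosetNodes i I, ∀ a : ℕ, g ++ [a] <+: h → (x I : ℕ) = a

/-- Player `i` plays, under `x`, to the sequence that ends with action `a` at infoset `I`. -/
def ReachesSeq {i : Fin n} (x : G.Pure i) (I : G.infosets i) (a : ℕ) : Prop :=
  ∃ h ∈ G.infosetNodes i I, G.Reaches x h ∧ (x I : ℕ) = a

/-- The partial order on the information sets of a player: some history in `I` passes through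
(or lies in) `J`. -/
def Precedes {i : Fin n} (J I : G.infosets i) : Prop :=
  ∃ h ∈ G.infosetNodes i I, ∃ g ∈ G.infosetNodes i J, g <+: h

/-- The probability that chance plays all its actions on the path from the root to `h`. -/
noncomputable def chanceReach (h : List ℕ) : ℝ :=
  ∏ k : Fin h.length,
    if G.owner (h.take k) = none then (G.chanceProb (h.take k) (h.get k)).val else 1

open Classical in
/-- The probability that the terminal history `z` is reached under the pure profile `x`. -/
noncomputable def reachProb (x : G.Profile) (z : List ℕ) : ℝ :=
  G.chanceReach z * ∏ i, if G.Reaches (x i) z then 1 else 0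

/-- Expected utility of player `i` under a pure profile. -/
noncomputable def utility (i : Fin n) (x : G.Profile) : ℝ :=
  ∑ z ∈ G.terminals, (G.util i z).val * G.reachProb x z

/-- The probability of the terminal history `z` under the correlated profile `μ`. -/
noncomputable def outcome (μ : G.Profile → ℝ) (z : List ℕ) : ℝ := ∑ x, μ x * G.reachProb x z

/-- Two correlated profiles are outcome-equivalent if they induce the same distribution over
terminal histories. -/
def OutcomeEquivalent (μ ν : G.Profile → ℝ) : Prop :=
  ∀ z ∈ G.terminals, G.outcome μ z = G.outcome ν z

/-- Regret of player `i` under `μ` against the deviation `φ`. -/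
noncomputable def regret (μ : G.Profile → ℝ) (i : Fin n) (φ : G.Pure i → G.Pure i) : ℝ :=
  ∑ x, μ x * (G.utility i (Function.update x i (φ (x i))) - G.utility i x)

/-- Causal deviations: the action chosen at `I` depends only on `I` and on which sequences `Ja`
with `J` weakly preceding `I` are played to by the recommended strategy. -/
def IsCausal {i : Fin n} (φ : G.Pure i → G.Pure i) : Prop :=
  ∀ (I : G.infosets i) (x y : G.Pure i),
    (∀ J : G.infosets i, G.Precedes J I → ∀ a ∈ G.infosetActions i J,
      (G.ReachesSeq x J a ↔ G.ReachesSeq y J a)) → φ x I = φ y I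

/-- `μ` is an `ε`-extensive-form correlated equilibrium. -/
def IsEFCE (ε : ℝ) (μ : G.Profile → ℝ) : Prop :=
  μ ∈ stdSimplex ℝ G.Profile ∧
    ∀ (i : Fin n) (φ : G.Pure i → G.Pure i), G.IsCausal φ → G.regret μ i φ ≤ ε

/-- The mixture, with weights `w`, of the products of the mixed strategies `σ t i`. -/
noncomputable def mixture {T : ℕ} (w : Fin T → ℝ) (σ : Fin T → (i : Fin n) → G.Pure i → ℝ) :
    G.Profile → ℝ :=
  fun x => ∑ t, w t * ∏ i, σ t i (x i)

/-- A mixture of `T` products of behavior strategies, given by the probabilities of the actions at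
each information set. -/
structure BehavioralMixture (T : ℕ) where
  weight : Fin T → Frac
  weight_nonneg : ∀ t, 0 ≤ (weight t).val
  weight_sum : ∑ t, (weight t).val = 1
  prob : Fin T → (i : Fin n) → (I : G.infosets i) → G.infosetActions i (I : ℕ) → Frac
  prob_nonneg : ∀ t i I a, 0 ≤ (prob t i I a).val
  prob_sum : ∀ t i I, ∑ a, (prob t i I a).val = 1

/-- The correlated profile of a mixture of products of behavior strategies: in each factor the
actions at the different information sets are drawn independently. -/
noncomputable def BehavioralMixture.dist {G : Game n} {T : ℕ} (π : G.BehavioralMixture T) :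
    G.Profile → ℝ :=
  G.mixture (fun t => (π.weight t).val) (fun t i x => ∏ I, (π.prob t i I (x I)).val)

/-- A mixture of `T` products in which every factor is a mixture of `K` pure strategies. -/
structure SmallSupportMixture (T K : ℕ) where
  weight : Fin T → Frac
  weight_nonneg : ∀ t, 0 ≤ (weight t).val
  weight_sum : ∑ t, (weight t).val = 1
  coeff : Fin T → Fin n → Fin K → Frac
  coeff_nonneg : ∀ t i k, 0 ≤ (coeff t i k).val
  coeff_sum : ∀ t i, ∑ k, (coeff t i k).val = 1
  strat : Fin T → (i : Fin n) → Fin K → G.Pure i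

/-- The correlated profile of a mixture of small-support products. -/
noncomputable def SmallSupportMixture.dist {G : Game n} {T K : ℕ}
    (π : G.SmallSupportMixture T K) : G.Profile → ℝ :=
  G.mixture (fun t => (π.weight t).val)
    (fun t i x => ∑ k, (π.coeff t i k).val * if π.strat t i k = x then 1 else 0)

end Game

/-! ### Encoding of inputs and outputs -/

/-- Encoding of a fraction by numerator and denominator. -/
def Frac.encode (q : Frac) : Val := .cons (.int q.num) (Val.ofNat q.den)

namespace Game

variable {n : ℕ} (G : Game n)

/-- Encoding of a history. -/
def encodeHistory (h : List ℕ) : Val := Val.ofList (h.map Val.ofNat)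

/-- Encoding of the node `h`: the history, followed by
the tag `0` and the utilities if `h` is terminal,
the tag `1` and the action probabilities if `h` is a chance node,
the tag `2`, the player, the information set and the actions otherwise. -/
def encodeNode (h : List ℕ) : Val :=
  .cons (encodeHistory h)
    (if G.actions h = ∅ then
      .cons (.int 0) (Val.ofFamily fun i : Fin n => (G.util i h).encode)
    else match G.owner h with
      | none => .cons (.int 1)
          (Val.ofFamily fun a : G.actions h =>
            .cons (Val.ofNat a) (G.chanceProb h a).encode)
      | some i => .cons (.int 2) (.cons (Val.ofNat i) (.cons (Val.ofNat (G.infoset h))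
          (Val.ofFamily fun a : G.actions h => Val.ofNat a))))

/-- Encoding of a game: the list of its nodes. -/
def encode : Val := Val.ofFamily fun h : G.hist => G.encodeNode h

variable {G}

/-- Encoding of a mixture of products of behavior strategies. -/
def BehavioralMixture.encode {T : ℕ} (π : G.BehavioralMixture T) : Val :=
  Val.ofFamily fun t : Fin T => .cons (π.weight t).encode
    (Val.ofFamily fun i : Fin n => Val.ofFamily fun I : G.infosets i =>
      .cons (Val.ofNat I) (Val.ofFamily fun a : G.infosetActions i (I : ℕ) =>
        .cons (Val.ofNat a) (π.prob t i I a).encode))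

/-- Encoding of a mixture of small-support products. -/
def SmallSupportMixture.encode {T K : ℕ} (π : G.SmallSupportMixture T K) : Val :=
  Val.ofFamily fun t : Fin T => .cons (π.weight t).encode
    (Val.ofFamily fun i : Fin n => Val.ofFamily fun k : Fin K =>
      .cons (π.coeff t i k).encode (Val.ofFamily fun I : G.infosets i =>
        .cons (Val.ofNat I) (Val.ofNat (π.strat t i k I))))

/-- Encoding of an input: the game together with the mixture. -/
def BehavioralMixture.encodeInput {T : ℕ} (π : G.BehavioralMixture T) : Val :=
  .cons G.encode π.encode

end Game

theorem Polynomial.eval_monotone_nat (p : Polynomial ℕ) : Monotone fun N => p.eval N := by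
  intro a b hab
  induction p using Polynomial.induction_on' with
  | add p q hp hq => simpa using add_le_add hp hq
  | monomial k c => simpa using Nat.mul_le_mul_left c (Nat.pow_le_pow_left hab k)

namespace Val

theorem one_le_size (v : Val) : 1 ≤ v.size := by
  cases v <;> simp only [size] <;> omega

theorem size_hd_le (v : Val) : v.hd.size ≤ v.size := by
  cases v <;> simp only [size, hd] <;> omega

theorem size_tl_le (v : Val) : v.tl.size ≤ v.size := by
  cases v <;> simp only [size, tl] <;> omega

theorem size_ofBool_le (b : Bool) : (ofBool b).size ≤ 2 := by
  cases b <;> decide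

theorem size_toInt_le (v : Val) : (int v.toInt).size ≤ v.size := by
  cases v <;> simp [size, toInt, add_assoc]

theorem size_add_le (a b : ℤ) : (int (a + b)).size ≤ (int a).size + (int b).size := by
  have ha := Nat.lt_size_self a.natAbs
  have hb := Nat.lt_size_self b.natAbs
  have h : (a + b).natAbs.size ≤ a.natAbs.size + b.natAbs.size + 1 := by
    rw [Nat.size_le]
    have h1 := Int.natAbs_add_le a b
    have h2 : 2 ^ a.natAbs.size ≤ 2 ^ (a.natAbs.size + b.natAbs.size) :=
      Nat.pow_le_pow_right (by norm_num) (by omega)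
    have h3 : 2 ^ b.natAbs.size ≤ 2 ^ (a.natAbs.size + b.natAbs.size) :=
      Nat.pow_le_pow_right (by norm_num) (by omega)
    rw [pow_succ]
    omega
  simp only [size]
  omega

theorem size_neg (a : ℤ) : (int (-a)).size = (int a).size := by simp [size]

theorem size_mul_le (a b : ℤ) : (int (a * b)).size ≤ (int a).size + (int b).size := by
  have ha := Nat.lt_size_self a.natAbs
  have hb := Nat.lt_size_self b.natAbs
  have h : (a * b).natAbs.size ≤ a.natAbs.size + b.natAbs.size := by
    rw [Nat.size_le, Int.natAbs_mul, pow_add]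
    exact Nat.mul_lt_mul'' ha hb
  simp only [size]
  omega

theorem size_ofNat_le (m : ℕ) : (ofNat m).size ≤ 1 + m := by
  have : Nat.size m ≤ m := Nat.size_le.2 Nat.lt_two_pow_self
  simpa [ofNat, size] using this

@[simp] theorem ofList_nil : ofList [] = nil := rfl

@[simp] theorem ofList_cons (v : Val) (l : List Val) : ofList (v :: l) = cons v (ofList l) := rfl

theorem length_lt_size_ofList (l : List Val) : l.length < (ofList l).size := by
  induction l with
  | nil => simp [size]
  | cons v l ih => simp [size]; have := one_le_size v; omega

theorem size_le_of_mem {l : List Val} {v : Val} (h : v ∈ l) : v.size ≤ (ofList l).size := by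
  induction l with
  | nil => simp at h
  | cons w l ih =>
    simp only [ofList_cons, size]
    rcases List.mem_cons.1 h with rfl | h
    · omega
    · have := ih h; omega

theorem size_ofList_le_cons (v : Val) (l : List Val) : (ofList l).size ≤ (ofList (v :: l)).size := by
  simp [size]

theorem ofNat_injective : Function.Injective ofNat := fun a b h => by simpa [ofNat] using h

end Val

theorem Op.exists_size_eval_le (o : Op) : ∃ c, ∀ v, (o.eval v).size ≤ v.size + c := by
  have key : ∀ v : Val, (Val.int v.hd.toInt).size + (Val.int v.tl.toInt).size ≤ v.size + 2 := by
    intro v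
    cases v with
    | cons a b =>
      have h1 := a.size_toInt_le
      have h2 := b.size_toInt_le
      simp only [Val.hd, Val.tl, Val.size] at *
      omega
    | _ => simp [Val.size, Val.hd, Val.tl, Val.toInt]
  cases o with
  | id => exact ⟨0, fun v => le_rfl⟩
  | const w => exact ⟨w.size, fun v => by simp [Op.eval]⟩
  | hd => exact ⟨0, fun v => v.size_hd_le⟩
  | tl => exact ⟨0, fun v => v.size_tl_le⟩
  | isCons => exact ⟨2, fun v => (Val.size_ofBool_le _).trans (by omega)⟩
  | isInt => exact ⟨2, fun v => (Val.size_ofBool_le _).trans (by omega)⟩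
  | eq => exact ⟨2, fun v => (Val.size_ofBool_le _).trans (by omega)⟩
  | lt => exact ⟨2, fun v => (Val.size_ofBool_le _).trans (by omega)⟩
  | add => exact ⟨2, fun v => (Val.size_add_le _ _).trans (key v)⟩
  | sub =>
    refine ⟨2, fun v => ?_⟩
    have := Val.size_add_le v.hd.toInt (-v.tl.toInt)
    rw [Val.size_neg, ← sub_eq_add_neg] at this
    exact this.trans (key v)
  | mul => exact ⟨2, fun v => (Val.size_mul_le _ _).trans (key v)⟩

theorem Prog.Run.size_le {f : Prog} {v w : Val} {t : ℕ} (h : Prog.Run f v w t) : w.size ≤ t := by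
  induction h with
  | pair => simp only [Val.size]; omega
  | _ => omega

/-- `F x` is computed from `e x` in time polynomial in the size of `e x`. -/
def PolyTime {X : Type*} (e F : X → Val) : Prop :=
  ∃ (P : Prog) (p : Polynomial ℕ), ∀ x, ∃ t, P.Run (e x) (F x) t ∧ t ≤ p.eval (e x).size

/-- The property `c x` is decided from `e x` in time polynomial in the size of `e x`. -/
def PolyDec {X : Type*} (e : X → Val) (c : X → Prop) : Prop :=
  PolyTime e fun x => open Classical in Val.ofBool (decide (c x))

namespace PolyTime

variable {X : Type*} {e F F' : X → Val}

theorem exists_size_le (h : PolyTime e F) :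
    ∃ p : Polynomial ℕ, ∀ x, (F x).size ≤ p.eval (e x).size := by
  obtain ⟨P, p, h⟩ := h
  refine ⟨p, fun x => ?_⟩
  obtain ⟨t, h1, h2⟩ := h x
  exact h1.size_le.trans h2

theorem congr (h : PolyTime e F) (hF : ∀ x, F x = F' x) : PolyTime e F' := by
  rwa [funext hF] at h

theorem id : PolyTime e e :=
  ⟨.op .id, 1 + .X + .X, fun x => ⟨_, .op .id _, by simp [Op.eval]⟩⟩

theorem comp {Y : Type*} {e' F' : Y → Val} (r : X → Y) (hr : PolyTime e fun x => e' (r x))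
    (hF : PolyTime e' F') : PolyTime e fun x => F' (r x) := by
  obtain ⟨P, p, hP⟩ := hr
  obtain ⟨Q, q, hQ⟩ := hF
  refine ⟨.seq P Q, 1 + p + q.comp p, fun x => ?_⟩
  obtain ⟨s, hs, hs'⟩ := hP x
  obtain ⟨t, ht, ht'⟩ := hQ (r x)
  refine ⟨_, .seq hs ht, ?_⟩
  have := q.eval_monotone_nat (hs.size_le.trans hs')
  simp only [Polynomial.eval_add, Polynomial.eval_comp, Polynomial.eval_one] at *
  omega

/-- A program applies to any family of inputs that its input family contains. -/
theorem restrict {Y : Type*} (r : Y → X) (hF : PolyTime e F) :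
    PolyTime (fun y => e (r y)) fun y => F (r y) := by
  obtain ⟨P, p, hP⟩ := hF
  exact ⟨P, p, fun y => hP (r y)⟩

theorem apply (o : Op) (h : PolyTime e F) : PolyTime e fun x => o.eval (F x) := by
  obtain ⟨c, hc⟩ := o.exists_size_eval_le
  refine h.comp (e' := fun v : Val => v) F ⟨.op o, 1 + .X + .X + .C c, fun v => ⟨_, .op o v, ?_⟩⟩
  have := hc v
  simp
  omega

theorem const (w : Val) : PolyTime e fun _ => w := (id (e := e)).apply (.const w)

theorem hd (h : PolyTime e F) : PolyTime e fun x => (F x).hd := h.apply .hd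

theorem tl (h : PolyTime e F) : PolyTime e fun x => (F x).tl := h.apply .tl

theorem pair (h : PolyTime e F) (h' : PolyTime e F') :
    PolyTime e fun x => .cons (F x) (F' x) := by
  obtain ⟨P, p, hP⟩ := h
  obtain ⟨Q, q, hQ⟩ := h'
  refine ⟨.pair P Q, 1 + .X + p + q, fun x => ?_⟩
  obtain ⟨s, hs, hs'⟩ := hP x
  obtain ⟨t, ht, ht'⟩ := hQ x
  exact ⟨_, .pair hs ht, by simp; omega⟩

theorem sub {f g : X → ℤ} (hf : PolyTime e fun x => .int (f x))
    (hg : PolyTime e fun x => .int (g x)) : PolyTime e fun x => .int (f x - g x) :=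
  (hf.pair hg).apply .sub

theorem mul {f g : X → ℤ} (hf : PolyTime e fun x => .int (f x))
    (hg : PolyTime e fun x => .int (g x)) : PolyTime e fun x => .int (f x * g x) :=
  (hf.pair hg).apply .mul

theorem ite {c : X → Prop} [DecidablePred c] (hc : PolyDec e c)
    (hF : PolyTime (fun x : {x // c x} => e x) fun x => F x)
    (hF' : PolyTime (fun x : {x // ¬ c x} => e x) fun x => F' x) :
    PolyTime e fun x => if c x then F x else F' x := by
  obtain ⟨R, r, hR⟩ := hc
  obtain ⟨P, p, hP⟩ := hF
  obtain ⟨Q, q, hQ⟩ := hF'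
  refine ⟨.ite R P Q, 1 + .X + r + p + q, fun x => ?_⟩
  obtain ⟨s, hs, hs'⟩ := hR x
  by_cases hx : c x
  · obtain ⟨t, ht, ht'⟩ := hP ⟨x, hx⟩
    simp only [if_pos hx]
    exact ⟨_, .iteTrue hs (by simp [hx, Val.ofBool]) ht, by simp at *; omega⟩
  · obtain ⟨t, ht, ht'⟩ := hQ ⟨x, hx⟩
    simp only [if_neg hx]
    exact ⟨_, .iteFalse (s := s) (by simpa [hx, Val.ofBool] using hs) ht, by simp at *; omega⟩

end PolyTime

namespace PolyDec

variable {X : Type*} {e F F' : X → Val} {c d : X → Prop}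

theorem congr (h : PolyDec e c) (hc : ∀ x, c x ↔ d x) : PolyDec e d := by
  have : c = d := funext fun x => propext (hc x)
  rwa [this] at h

theorem eq (h : PolyTime e F) (h' : PolyTime e F') : PolyDec e fun x => F x = F' x :=
  ((h.pair h').apply .eq).congr fun x => by simp only [Op.eval, Val.hd, Val.tl]; congr

theorem lt {f g : X → ℤ} (hf : PolyTime e fun x => .int (f x))
    (hg : PolyTime e fun x => .int (g x)) : PolyDec e fun x => f x < g x :=
  ((hf.pair hg).apply .lt).congr fun x => by
    simp only [Op.eval, Val.hd, Val.tl, Val.toInt]; congr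

theorem isCons (h : PolyTime e F) : PolyDec e fun x => (F x).isCons = true :=
  (h.apply .isCons).congr fun x => by simp only [Op.eval]; simp

theorem restrict {Y : Type*} (r : Y → X) (h : PolyDec e c) :
    PolyDec (fun y => e (r y)) fun y => c (r y) := PolyTime.restrict r h

theorem and (hc : PolyDec e c) (hd : PolyDec (fun x : {x // c x} => e x) fun x => d x) :
    PolyDec e fun x => c x ∧ d x := by
  classical
  refine (PolyTime.ite hc (F := fun x => Val.ofBool (decide (d x)))
    (F' := fun _ => Val.ofBool false) (PolyTime.congr hd fun x => by congr)
    (PolyTime.const (Val.ofBool false))).congr fun x => ?_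
  by_cases h : c x <;> simp [h]

theorem and' (hc : PolyDec e c) (hd : PolyDec e d) : PolyDec e fun x => c x ∧ d x :=
  hc.and (hd.restrict Subtype.val)

theorem not (hc : PolyDec e c) : PolyDec e fun x => ¬ c x := by
  classical
  refine (PolyTime.ite hc (F := fun _ => Val.ofBool false) (F' := fun _ => Val.ofBool true)
    (PolyTime.const (Val.ofBool false)) (PolyTime.const (Val.ofBool true))).congr fun x => ?_
  by_cases h : c x <;> simp [h]

end PolyDec

namespace PolyTime

variable {X : Type*} {e : X → Val} {α : X → Type*} {l : ∀ x, List (α x)} {enc : ∀ x, α x → Val}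

/-- The environment `e` extended by an element of a list on top. -/
abbrev ext (e : X → Val) (enc : ∀ x, α x → Val) : (Σ x, α x) → Val :=
  fun p => .cons (enc p.1 p.2) (e p.1)

theorem weaken {F : X → Val} (h : PolyTime e F) : PolyTime (ext e enc) fun p => F p.1 :=
  comp (Y := X) (e' := e) Sigma.fst (id (e := ext e enc)).tl h

theorem top : PolyTime (ext e enc) fun p => enc p.1 p.2 := (id (e := ext e enc)).hd

theorem foldl_aux {step : ∀ x, Val → α x → Val}
    (hs : PolyTime (fun p : Σ x, Val × α x => .cons p.2.1 (.cons (enc p.1 p.2.2) (e p.1)))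
      fun p => step p.1 p.2.1 p.2.2) :
    ∃ (P : Prog) (p : Polynomial ℕ), ∀ (x : X) (M : ℕ) (l : List (α x)) (s : Val),
      (∀ l' : List (α x), l' <+: l → (l'.foldl (step x) s).size ≤ M) →
      ∃ t, P.Run (.cons (.cons (.ofList (l.map (enc x))) s) (e x))
        (.cons (.cons .nil (l.foldl (step x) s)) (e x)) t ∧
        t ≤ (l.length + 1) * p.eval ((Val.ofList (l.map (enc x))).size + M + (e x).size + 2) := by
  let eY : (Σ x, List (α x) × Val) → Val := fun y =>
    .cons (.cons (.ofList (y.2.1.map (enc y.1))) y.2.2) (e y.1)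
  let eZ : (Σ x, α x × List (α x) × Val) → Val := fun y => eY ⟨y.1, y.2.1 :: y.2.2.1, y.2.2.2⟩
  have hC : PolyDec eY fun y => (eY y).hd.hd.isCons = true := PolyDec.isCons id.hd.hd
  have hB : PolyTime eZ fun z => eY ⟨z.1, z.2.2.1, step z.1 z.2.2.2 z.2.1⟩ := by
    have h0 : PolyTime eZ eZ := id
    have h1 : PolyTime eZ fun z => step z.1 z.2.2.2 z.2.1 :=
      comp (Y := Σ x, Val × α x) (fun z : Σ x, α x × List (α x) × Val => ⟨z.1, z.2.2.2, z.2.1⟩)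
        (h0.hd.tl.pair (h0.hd.hd.hd.pair h0.tl)) hs
    exact (h0.hd.hd.tl.pair h1).pair h0.tl
  obtain ⟨C, pc, hC⟩ := hC
  obtain ⟨B, pb, hB⟩ := hB
  refine ⟨.loop C B, 1 + .X + pc + pb, fun x M l => ?_⟩
  induction l with
  | nil =>
    intro s hM
    obtain ⟨t, ht, ht'⟩ := hC ⟨x, [], s⟩
    have hM0 : s.size ≤ M := hM [] (List.prefix_refl _)
    refine ⟨_, .loopDone (s := t) (by simpa [eY, Val.hd, Val.isCons, Val.ofBool] using ht), ?_⟩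
    have hle : (eY ⟨x, [], s⟩).size ≤ 1 + M + (e x).size + 2 := by
      simp [eY, Val.size]; omega
    have := pc.eval_monotone_nat hle
    simp [eY, Val.size] at *
    omega
  | cons a l ih =>
    intro s hM
    obtain ⟨t, ht, ht'⟩ := hC ⟨x, a :: l, s⟩
    obtain ⟨r, hr, hr'⟩ := hB ⟨x, a, l, s⟩
    obtain ⟨u, hu, hu'⟩ := ih (step x s a) fun l' hl' => hM (a :: l') (by simpa using hl')
    have hM0 : s.size ≤ M := hM [] (by simp)
    refine ⟨_, .loopNext (b := .int 1) (s := t) (by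
      simpa [eY, Val.hd, Val.isCons, Val.ofBool] using ht) (by simp) hr hu, ?_⟩
    set N := (Val.ofList ((a :: l).map (enc x))).size + M + (e x).size + 2 with hN
    have hle : (eY ⟨x, a :: l, s⟩).size ≤ N := by
      simp only [eY, Val.size, hN]; omega
    have h1 := pc.eval_monotone_nat hle
    have h2 := pb.eval_monotone_nat hle
    have h3 : u ≤ (l.length + 1) * (1 + .X + pc + pb : Polynomial ℕ).eval N := by
      refine hu'.trans (Nat.mul_le_mul_left _ (Polynomial.eval_monotone_nat _ ?_))
      have := Val.size_ofList_le_cons (enc x a) (l.map (enc x))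
      simp only [hN, List.map_cons]
      omega
    simp only [Polynomial.eval_add, Polynomial.eval_one, Polynomial.eval_X, List.length_cons,
      eY, eZ] at *
    nlinarith

theorem foldl {init : X → Val} {step : ∀ x, Val → α x → Val}
    (hl : PolyTime e fun x => .ofList ((l x).map (enc x))) (hi : PolyTime e init)
    (hs : PolyTime (fun p : Σ x, Val × α x => .cons p.2.1 (.cons (enc p.1 p.2.2) (e p.1)))
      fun p => step p.1 p.2.1 p.2.2)
    (hb : ∃ p : Polynomial ℕ, ∀ x, ∀ l', l' <+: l x →
      (l'.foldl (step x) (init x)).size ≤ p.eval (e x).size) :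
    PolyTime e fun x => (l x).foldl (step x) (init x) := by
  obtain ⟨b, hb⟩ := hb
  obtain ⟨pl, hpl⟩ := hl.exists_size_le
  obtain ⟨P, p, hP⟩ := foldl_aux hs
  suffices h : PolyTime (fun x => .cons (.cons (.ofList ((l x).map (enc x))) (init x)) (e x))
      fun x => .cons (.cons .nil ((l x).foldl (step x) (init x))) (e x) by
    have h0 := (hl.pair hi).pair (id (e := e))
    exact (comp (fun x => x) h0 h).hd.tl
  refine ⟨P, .X * p.comp (.X + b + .X + 2), fun x => ?_⟩
  obtain ⟨t, ht, ht'⟩ := hP x (b.eval (e x).size) (l x) (init x) (hb x)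
  refine ⟨t, ht, ht'.trans ?_⟩
  simp only [Polynomial.eval_mul, Polynomial.eval_X, Polynomial.eval_comp, Polynomial.eval_add,
    Polynomial.eval_ofNat]
  set A := Val.ofList ((l x).map (enc x)) with hA
  have h1 : (l x).length < A.size := by
    simpa using Val.length_lt_size_ofList ((l x).map (enc x))
  have hN : A.size + (e x).size ≤ (Val.cons (.cons A (init x)) (e x)).size := by
    simp [Val.size]; omega
  have h2 : (e x).size ≤ (Val.cons (.cons A (init x)) (e x)).size := by omega
  have h3 := b.eval_monotone_nat h2
  simp only at h3
  exact Nat.mul_le_mul (by omega) (p.eval_monotone_nat (by omega))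

/-- Folding with a step that increases the size of the state by a polynomially bounded amount. -/
theorem foldl_of_growth {init : X → Val} {step : ∀ x, Val → α x → Val}
    (hl : PolyTime e fun x => .ofList ((l x).map (enc x))) (hi : PolyTime e init)
    (hs : PolyTime (fun p : Σ x, Val × α x => .cons p.2.1 (.cons (enc p.1 p.2.2) (e p.1)))
      fun p => step p.1 p.2.1 p.2.2)
    (hg : ∃ p : Polynomial ℕ, ∀ x s a,
      (step x s a).size ≤ s.size + p.eval (.cons (enc x a) (e x) : Val).size) :
    PolyTime e fun x => (l x).foldl (step x) (init x) := by
  refine foldl hl hi hs ?_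
  obtain ⟨p, hp⟩ := hg
  obtain ⟨pl, hpl⟩ := hl.exists_size_le
  obtain ⟨pi, hpi⟩ := hi.exists_size_le
  refine ⟨pi + pl * p.comp (1 + pl + .X), fun x l' hl' => ?_⟩
  have hlen : l'.length ≤ pl.eval (e x).size := by
    have := Val.length_lt_size_ofList ((l x).map (enc x))
    have := hpl x
    have := hl'.length_le
    simp at *
    omega
  have key : ∀ (l' : List (α x)) (s : Val), (∀ a ∈ l', a ∈ l x) → (l'.foldl (step x) s).size ≤
      s.size + l'.length * p.eval (1 + pl.eval (e x).size + (e x).size) := by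
    intro l'
    induction l' with
    | nil => simp
    | cons a l' ih =>
      intro s hmem
      have h1 := ih (step x s a) fun b hb => hmem b (by simp [hb])
      have h2 := hp x s a
      have h3 : (enc x a).size ≤ pl.eval (e x).size :=
        (Val.size_le_of_mem (List.mem_map_of_mem (hmem a (by simp)))).trans (hpl x)
      have h4 := p.eval_monotone_nat
        (show (.cons (enc x a) (e x) : Val).size ≤ 1 + pl.eval (e x).size + (e x).size by
          simp only [Val.size]; omega)
      simp only [List.foldl_cons, List.length_cons] at *
      nlinarith
  have h1 := key l' (init x) fun a ha => hl'.subset ha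
  have h2 := hpi x
  have h3 := Nat.mul_le_mul_right (p.eval (1 + pl.eval (e x).size + (e x).size)) hlen
  simp
  omega

end PolyTime

namespace PolyTime

variable {X : Type*} {e : X → Val} {α : X → Type*} {l : ∀ x, List (α x)} {enc : ∀ x, α x → Val}

/-- The environment of the step of a fold: the state, an element of the list, and `e`. -/
abbrev stepEnv (e : X → Val) (enc : ∀ x, α x → Val) : (Σ x, Val × α x) → Val :=
  fun p => .cons p.2.1 (.cons (enc p.1 p.2.2) (e p.1))

theorem state : PolyTime (stepEnv e enc) fun p => p.2.1 := (id (e := stepEnv e enc)).hd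

theorem toStep {F : (Σ x, α x) → Val} (h : PolyTime (ext e enc) F) :
    PolyTime (stepEnv e enc) fun p => F ⟨p.1, p.2.2⟩ :=
  comp (Y := Σ x, α x) (e' := ext e enc) (fun p : Σ x, Val × α x => ⟨p.1, p.2.2⟩)
    (id (e := stepEnv e enc)).tl h

theorem foldl_select {init : X → Val} {c : ∀ x, α x → Prop} [∀ x, DecidablePred (c x)]
    {v : ∀ x, α x → Val} (hl : PolyTime e fun x => .ofList ((l x).map (enc x)))
    (hi : PolyTime e init) (hc : PolyDec (ext e enc) fun p => c p.1 p.2)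
    (hv : PolyTime (ext e enc) fun p => v p.1 p.2) :
    PolyTime e fun x => (l x).foldl (fun s a => if c x a then v x a else s) (init x) := by
  refine foldl_of_growth hl hi (step := fun x s a => if c x a then v x a else s) ?_ ?_
  · have h1 : PolyDec (stepEnv e enc) fun p => c p.1 p.2.2 := toStep hc
    exact ite (c := fun p : Σ x, Val × α x => c p.1 p.2.2)
      (F := fun p => v p.1 p.2.2) (F' := fun p => p.2.1) h1
      ((toStep hv).restrict Subtype.val) (state.restrict Subtype.val)
  · obtain ⟨p, hp⟩ := hv.exists_size_le
    refine ⟨p, fun x s a => ?_⟩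
    have := hp ⟨x, a⟩
    simp only [ext] at this
    split_ifs <;> omega

theorem sum {f : ∀ x, α x → ℤ} (hl : PolyTime e fun x => .ofList ((l x).map (enc x)))
    (hf : PolyTime (ext e enc) fun p => .int (f p.1 p.2)) :
    PolyTime e fun x => .int ((l x).map (f x)).sum := by
  have h := foldl_of_growth hl (const (.int 0)) (step := fun x s a => .int (s.toInt + f x a))
    ((state.pair (toStep hf)).apply .add) (by
      obtain ⟨p, hp⟩ := hf.exists_size_le
      refine ⟨p, fun x s a => (Val.size_add_le _ _).trans ?_⟩
      exact add_le_add s.size_toInt_le (hp ⟨x, a⟩))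
  refine h.congr fun x => ?_
  have key : ∀ (l : List (α x)) (z : ℤ), l.foldl (fun s a => Val.int (s.toInt + f x a)) (.int z) =
      .int (z + (l.map (f x)).sum) := by
    intro l
    induction l with
    | nil => simp
    | cons a l ih =>
      intro z
      rw [List.foldl_cons, ih, Val.toInt]
      simp [add_assoc]
  simpa using key (l x) 0

theorem prod {f : ∀ x, α x → ℤ} (hl : PolyTime e fun x => .ofList ((l x).map (enc x)))
    (hf : PolyTime (ext e enc) fun p => .int (f p.1 p.2)) :
    PolyTime e fun x => .int ((l x).map (f x)).prod := by
  have h := foldl_of_growth hl (const (.int 1)) (step := fun x s a => .int (s.toInt * f x a))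
    ((state.pair (toStep hf)).apply .mul) (by
      obtain ⟨p, hp⟩ := hf.exists_size_le
      refine ⟨p, fun x s a => (Val.size_mul_le _ _).trans ?_⟩
      exact add_le_add s.size_toInt_le (hp ⟨x, a⟩))
  refine h.congr fun x => ?_
  have key : ∀ (l : List (α x)) (z : ℤ), l.foldl (fun s a => Val.int (s.toInt * f x a)) (.int z) =
      .int (z * (l.map (f x)).prod) := by
    intro l
    induction l with
    | nil => simp
    | cons a l ih =>
      intro z
      rw [List.foldl_cons, ih, Val.toInt]
      simp [mul_assoc]
  simpa using key (l x) 1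

theorem reverse_map {g : ∀ x, α x → Val} (hl : PolyTime e fun x => .ofList ((l x).map (enc x)))
    (hg : PolyTime (ext e enc) fun p => g p.1 p.2) :
    PolyTime e fun x => .ofList ((l x).reverse.map (g x)) := by
  have h := foldl_of_growth hl (const .nil) (step := fun x s a => .cons (g x a) s)
    ((toStep hg).pair state) (by
      obtain ⟨p, hp⟩ := hg.exists_size_le
      refine ⟨1 + p, fun x s a => ?_⟩
      have := hp ⟨x, a⟩
      simp only [Val.size, Polynomial.eval_add, Polynomial.eval_one] at *
      omega)
  refine h.congr fun x => ?_
  have key : ∀ (l : List (α x)) (r : List Val), l.foldl (fun s a => Val.cons (g x a) s) (.ofList r) =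
      .ofList (l.reverse.map (g x) ++ r) := by
    intro l
    induction l with
    | nil => simp
    | cons a l ih => intro r; rw [List.foldl_cons, ← Val.ofList_cons, ih]; simp
  simpa using key (l x) []

theorem map {g : ∀ x, α x → Val} (hl : PolyTime e fun x => .ofList ((l x).map (enc x)))
    (hg : PolyTime (ext e enc) fun p => g p.1 p.2) :
    PolyTime e fun x => .ofList ((l x).map (g x)) := by
  have h := reverse_map (l := fun x => (l x).reverse) (g := g) (reverse_map hl top) hg
  exact h.congr fun x => by simp

theorem zipIdx {F : X → List Val} (hF : PolyTime e fun x => .ofList (F x)) :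
    PolyTime e fun x => .ofList ((F x).zipIdx.map fun p => .cons (.ofNat p.2) p.1) := by
  let step : X → Val → Val → Val := fun _ s a =>
    .cons (.int (s.hd.toInt + 1)) (.cons (.cons s.hd a) s.tl)
  have key : ∀ x (l : List Val) (k : ℕ) (r : List Val),
      l.foldl (step x) (.cons (.ofNat k) (.ofList r)) = .cons (.ofNat (k + l.length))
        (.ofList (((l.zipIdx k).map fun p => Val.cons (.ofNat p.2) p.1).reverse ++ r)) := by
    intro x l
    induction l with
    | nil => simp
    | cons a l ih =>
      intro k r
      have : step x (.cons (.ofNat k) (.ofList r)) a =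
          .cons (.ofNat (k + 1)) (.ofList (.cons (.ofNat k) a :: r)) := by
        simp [step, Val.hd, Val.tl, Val.toInt, Val.ofNat]
      rw [List.foldl_cons, this, ih]
      simp [add_comm, add_left_comm]
  have hl : PolyTime e fun x => .ofList ((F x).map fun v => v) := hF.congr fun x => by simp
  have h := foldl (α := fun _ => Val) (step := step) hl (const (.cons (.ofNat 0) (.ofList []))) (by
      have h1 : PolyTime (stepEnv e fun (_ : X) (v : Val) => v) fun p => p.2.1 := state
      have h2 : PolyTime (stepEnv e fun (_ : X) (v : Val) => v) fun p => p.2.2 := toStep top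
      exact ((h1.hd.pair (const (.int 1))).apply .add).pair ((h1.hd.pair h2).pair h1.tl)) (by
      obtain ⟨p, hp⟩ := hF.exists_size_le
      refine ⟨p * p + 5 * p + 5, fun x l' hl' => ?_⟩
      rw [key x]
      have hsize : ∀ (l : List Val) (k : ℕ) , ∀ r : List Val,
          (Val.ofList (((l.zipIdx k).map fun p => Val.cons (.ofNat p.2) p.1).reverse ++ r)).size ≤
          (Val.ofList l).size + (Val.ofList r).size + l.length * (2 + k + l.length) := by
        intro l
        induction l with
        | nil => simp
        | cons a l ih =>
          intro k r
          have h1 := ih (k + 1) (.cons (.ofNat k) a :: r)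
          have h2 := Val.size_ofNat_le k
          simp only [List.zipIdx_cons, List.map_cons, List.reverse_cons, List.append_assoc,
            List.cons_append, List.nil_append, Val.ofList_cons, Val.size, List.length_cons] at *
          nlinarith
      have h1 := hsize l' 0 []
      have h2 := Val.size_ofNat_le (0 + l'.length)
      have h3 : (Val.ofList l').size ≤ p.eval (e x).size := by
        refine le_trans ?_ (hp x)
        obtain ⟨r, hr⟩ := hl'
        rw [← hr]
        clear * -
        induction l' with
        | nil => simpa [Val.size] using Val.one_le_size _
        | cons a l ih => simp only [List.cons_append, Val.ofList_cons, Val.size]; omega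
      have h4 := Val.length_lt_size_ofList l'
      simp only [Val.size, Polynomial.eval_add, Polynomial.eval_mul, Polynomial.eval_ofNat,
        Val.ofList_nil] at *
      nlinarith)
  have h2 : PolyTime e fun x =>
      .ofList (((F x).zipIdx.map fun p => Val.cons (.ofNat p.2) p.1).reverse) :=
    h.tl.congr fun x => by rw [key x]; simp [Val.tl]
  have h3 := reverse_map (α := fun _ => Val) (enc := fun _ v => v) (g := fun _ v => v)
    (l := fun x => ((F x).zipIdx.map fun p => Val.cons (.ofNat p.2) p.1).reverse)
    (h2.congr fun x => by rw [List.map_id']) top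
  exact h3.congr fun x => by rw [List.map_id', List.reverse_reverse]

end PolyTime

theorem PolyDec.any {X : Type*} {e : X → Val} {α : X → Type*} {l : ∀ x, List (α x)}
    {enc : ∀ x, α x → Val} {c : ∀ x, α x → Prop}
    (hl : PolyTime e fun x => .ofList ((l x).map (enc x)))
    (hc : PolyDec (PolyTime.ext e enc) fun p => c p.1 p.2) :
    PolyDec e fun x => ∃ a ∈ l x, c x a := by
  classical
  have h := PolyTime.foldl_select (v := fun _ _ => .int 1) hl (.const .nil) hc (.const _)
  refine h.congr fun x => ?_
  have key : ∀ (l : List (α x)) (s : Val),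
      l.foldl (fun s a => if c x a then Val.int 1 else s) s = if ∃ a ∈ l, c x a then .int 1 else s := by
    intro l
    induction l with
    | nil => simp
    | cons a l ih =>
      intro s
      rw [List.foldl_cons, ih]
      by_cases h1 : c x a <;> simp [h1]
  rw [key]
  by_cases h1 : ∃ a ∈ l x, c x a
  · simp only [h1]; rfl
  · simp only [h1]; rfl

section Family

variable {X : Type*} {e : X → Val} {α : X → Type} [∀ x, Fintype (α x)] [∀ x, LinearOrder (α x)]
  {enc : ∀ x, α x → Val}

theorem List.sum_map_sort_univ {β M : Type*} [Fintype β] [LinearOrder β] [AddCommMonoid M]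
    (f : β → M) : (((univ : Finset β).sort (· ≤ ·)).map f).sum = ∑ a, f a := by
  rw [← List.sum_toFinset f (Finset.sort_nodup _ _), Finset.sort_toFinset]

theorem List.prod_map_sort_univ {β M : Type*} [Fintype β] [LinearOrder β] [CommMonoid M]
    (f : β → M) : (((univ : Finset β).sort (· ≤ ·)).map f).prod = ∏ a, f a := by
  rw [← List.prod_toFinset f (Finset.sort_nodup _ _), Finset.sort_toFinset]

theorem PolyTime.fintype_sum {f : ∀ x, α x → ℤ} (hl : PolyTime e fun x => .ofFamily (enc x))
    (hf : PolyTime (ext e enc) fun p => .int (f p.1 p.2)) :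
    PolyTime e fun x => .int (∑ a, f x a) :=
  (sum (l := fun x => (univ : Finset (α x)).sort (· ≤ ·)) hl hf).congr fun x => by
    rw [List.sum_map_sort_univ]

theorem PolyTime.fintype_prod {f : ∀ x, α x → ℤ} (hl : PolyTime e fun x => .ofFamily (enc x))
    (hf : PolyTime (ext e enc) fun p => .int (f p.1 p.2)) :
    PolyTime e fun x => .int (∏ a, f x a) :=
  (prod (l := fun x => (univ : Finset (α x)).sort (· ≤ ·)) hl hf).congr fun x => by
    rw [List.prod_map_sort_univ]

theorem PolyTime.family {g : ∀ x, α x → Val} (hl : PolyTime e fun x => .ofFamily (enc x))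
    (hg : PolyTime (ext e enc) fun p => g p.1 p.2) : PolyTime e fun x => .ofFamily (g x) :=
  map (l := fun x => (univ : Finset (α x)).sort (· ≤ ·)) hl hg

theorem PolyDec.exists {c : ∀ x, α x → Prop} (hl : PolyTime e fun x => .ofFamily (enc x))
    (hc : PolyDec (PolyTime.ext e enc) fun p => c p.1 p.2) : PolyDec e fun x => ∃ a, c x a :=
  (PolyDec.any (l := fun x => (univ : Finset (α x)).sort (· ≤ ·)) hl hc).congr fun x => by simp

end Family

theorem PolyTime.indexed {X : Type*} {e : X → Val} {n : X → ℕ} {enc : ∀ x, Fin (n x) → Val}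
    (h : PolyTime e fun x => .ofFamily (enc x)) :
    PolyTime e fun x => .ofFamily fun i : Fin (n x) => .cons (.ofNat i) (enc x i) := by
  refine (zipIdx h).congr fun x => ?_
  rw [Val.ofFamily, Fin.sort_univ]
  congr 1
  apply List.ext_getElem <;> simp

theorem Val.ofFamily_orderIso {α β : Type} [Fintype α] [LinearOrder α] [Fintype β] [LinearOrder β]
    (r : α ≃o β) (f : β → Val) : Val.ofFamily (fun a => f (r a)) = Val.ofFamily f := by
  have h : (univ : Finset β).sort (· ≤ ·) = ((univ : Finset α).sort (· ≤ ·)).map r := by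
    have := StrictMonoOn.map_finsetSort (f := r.toEquiv.toEmbedding) (s := univ)
      (r.strictMono.strictMonoOn _)
    rw [Finset.map_univ_equiv] at this
    exact this.symm
  rw [Val.ofFamily, Val.ofFamily, h, List.map_map]
  rfl

namespace Game

variable {n : ℕ} (G : Game n) {i : Fin n}

theorem mem_hist_of_prefix {g h : List ℕ} (hgh : g <+: h) (hh : h ∈ G.hist) : g ∈ G.hist := by
  induction h using List.reverseRecOn with
  | nil => rwa [List.prefix_nil.1 hgh]
  | append_singleton h a ih =>
    rcases List.prefix_concat_iff.1 hgh with rfl | hgh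
    · exact hh
    · exact ih hgh (G.parent_mem _ _ hh)

theorem mem_nodes_of_append {g : List ℕ} {a : ℕ} (h : g ++ [a] ∈ G.hist)
    (ho : G.owner g = some i) : g ∈ G.nodes i := by
  refine mem_filter.2 ⟨G.parent_mem _ _ h, ?_, ho⟩
  exact ne_empty_of_mem ((G.mem_actions g a).2 h)

theorem mem_infosetNodes {g : List ℕ} {I : ℕ} :
    g ∈ G.infosetNodes i I ↔ g ∈ G.nodes i ∧ G.infoset g = I := mem_filter

theorem mem_infosets {g : List ℕ} {I : ℕ} (h : g ∈ G.infosetNodes i I) : I ∈ G.infosets i :=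
  mem_image.2 ⟨g, (G.mem_infosetNodes.1 h).1, (G.mem_infosetNodes.1 h).2⟩

theorem exists_infosetNode (I : G.infosets i) : ∃ g, g ∈ G.infosetNodes i I := by
  obtain ⟨g, hg, h⟩ := mem_image.1 I.2
  exact ⟨g, G.mem_infosetNodes.2 ⟨hg, h⟩⟩

theorem infosetNodes_subset_hist {g : List ℕ} {I : ℕ} (h : g ∈ G.infosetNodes i I) :
    g ∈ G.hist := (mem_filter.1 (G.mem_infosetNodes.1 h).1).1

theorem infosetActions_eq {g : List ℕ} {I : ℕ} (h : g ∈ G.infosetNodes i I) :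
    G.infosetActions i I = G.actions g := by
  obtain ⟨hg, rfl⟩ := G.mem_infosetNodes.1 h
  ext a
  simp only [GameForm.infosetActions, mem_biUnion]
  constructor
  · rintro ⟨g', hg', ha⟩
    obtain ⟨h1, h2⟩ := G.mem_infosetNodes.1 hg'
    rwa [G.same_actions i g hg g' h1 h2.symm]
  · exact fun ha => ⟨g, h, ha⟩

theorem append_mem_hist {g : List ℕ} {I a : ℕ} (h : g ∈ G.infosetNodes i I) :
    g ++ [a] ∈ G.hist ↔ a ∈ G.infosetActions i I := by
  rw [G.infosetActions_eq h, G.mem_actions]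

theorem infosetActions_nonempty (I : G.infosets i) : (G.infosetActions i (I : ℕ)).Nonempty := by
  obtain ⟨g, hg⟩ := G.exists_infosetNode I
  rw [G.infosetActions_eq hg, nonempty_iff_ne_empty]
  exact (mem_filter.1 (G.mem_infosetNodes.1 hg).1).2.1

theorem mem_sequence {h : List ℕ} (hh : h ∈ G.hist) {I a : ℕ} :
    (I, a) ∈ G.sequence i h ↔ ∃ g ∈ G.infosetNodes i I, g ++ [a] <+: h := by
  simp only [GameForm.sequence, List.mem_filterMap, List.mem_finRange, true_and]
  constructor
  · rintro ⟨k, hk⟩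
    split_ifs at hk with ho
    obtain ⟨hI, ha⟩ := Prod.ext_iff.1 (Option.some_injective _ hk)
    have hp : h.take k ++ [a] <+: h := by
      simp only at ha
      rw [← ha, List.get_eq_getElem, List.take_append_getElem]
      exact List.take_prefix _ _
    exact ⟨_, G.mem_infosetNodes.2 ⟨G.mem_nodes_of_append (G.mem_hist_of_prefix hp hh) ho, hI⟩, hp⟩
  · rintro ⟨g, hg, r, rfl⟩
    obtain ⟨hn, rfl⟩ := G.mem_infosetNodes.1 hg
    refine ⟨⟨g.length, by simp⟩, ?_⟩
    simp [(mem_filter.1 hn).2.2]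

theorem sequence_eq {g h : List ℕ} {I : ℕ} (hg : g ∈ G.infosetNodes i I)
    (hh : h ∈ G.infosetNodes i I) : G.sequence i g = G.sequence i h := by
  obtain ⟨h1, rfl⟩ := G.mem_infosetNodes.1 hg
  obtain ⟨h2, e⟩ := G.mem_infosetNodes.1 hh
  exact G.perfect_recall i g h1 h h2 e.symm

/-- A player does not pass through an information set before reaching it. -/
theorem notMem_sequence {g : List ℕ} {I a : ℕ} (hg : g ∈ G.infosetNodes i I) :
    (I, a) ∉ G.sequence i g := by
  obtain ⟨m, hm, hmin⟩ := exists_min_image (G.infosetNodes i I) List.length ⟨g, hg⟩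
  rw [G.sequence_eq hg hm, G.mem_sequence (G.infosetNodes_subset_hist hm)]
  rintro ⟨g', hg', hp⟩
  have := hp.length_le
  have := hmin g' hg'
  simp at *
  omega

theorem mem_sequence_append {g : List ℕ} {a J b : ℕ} (h : g ++ [a] ∈ G.hist) :
    (J, b) ∈ G.sequence i (g ++ [a]) ↔
      (J, b) ∈ G.sequence i g ∨ g ∈ G.infosetNodes i J ∧ a = b := by
  rw [G.mem_sequence h, G.mem_sequence (G.parent_mem _ _ h)]
  constructor
  · rintro ⟨g', hg', hp⟩
    rcases List.prefix_concat_iff.1 hp with e | hp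
    · obtain ⟨rfl, e⟩ := List.append_inj' e rfl
      exact .inr ⟨hg', by simpa using e.symm⟩
    · exact .inl ⟨g', hg', hp⟩
  · rintro (⟨g', hg', hp⟩ | ⟨hg, rfl⟩)
    · exact ⟨g', hg', hp.trans (List.prefix_append _ _)⟩
    · exact ⟨g, hg, List.prefix_refl _⟩

theorem reaches_iff {h : List ℕ} (hh : h ∈ G.hist) (x : G.Pure i) :
    G.Reaches x h ↔ ∀ (I : G.infosets i) (a : ℕ), ((I : ℕ), a) ∈ G.sequence i h → (x I : ℕ) = a := by
  refine forall_congr' fun I => ⟨fun H a ha => ?_, fun H g hg a hp => ?_⟩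
  · obtain ⟨g, hg, hp⟩ := (G.mem_sequence hh).1 ha
    exact H g hg a hp
  · exact H a ((G.mem_sequence hh).2 ⟨g, hg, hp⟩)

theorem reaches_nil (x : G.Pure i) : G.Reaches x [] := by
  intro I g _ a hp
  simp at hp

theorem Reaches.of_prefix {G : Game n} {x : G.Pure i} {g h : List ℕ} (H : G.Reaches x h)
    (hp : g <+: h) : G.Reaches x g := fun I g' hg' a ha => H I g' hg' a (ha.trans hp)

theorem reaches_append {g : List ℕ} {a : ℕ} (h : g ++ [a] ∈ G.hist) (x : G.Pure i) :
    G.Reaches x (g ++ [a]) ↔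
      G.Reaches x g ∧ ∀ I : G.infosets i, g ∈ G.infosetNodes i I → (x I : ℕ) = a := by
  rw [G.reaches_iff h, G.reaches_iff (G.parent_mem _ _ h)]
  simp only [G.mem_sequence_append h]
  constructor
  · exact fun H => ⟨fun I b hb => H I b (.inl hb), fun I hI => H I a (.inr ⟨hI, rfl⟩)⟩
  · rintro ⟨H1, H2⟩ I b (hb | ⟨hI, rfl⟩)
    · exact H1 I b hb
    · exact H2 I hI

theorem reaches_append_of_notMem {g : List ℕ} {a : ℕ} (h : g ++ [a] ∈ G.hist)
    (hg : g ∉ G.nodes i) (x : G.Pure i) : G.Reaches x (g ++ [a]) ↔ G.Reaches x g := by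
  rw [G.reaches_append h, and_iff_left]
  exact fun I hI => absurd (G.mem_infosetNodes.1 hI).1 hg

theorem reaches_append_of_mem {g : List ℕ} {a : ℕ} {I : G.infosets i} (h : g ++ [a] ∈ G.hist)
    (hg : g ∈ G.infosetNodes i I) (x : G.Pure i) :
    G.Reaches x (g ++ [a]) ↔ G.Reaches x g ∧ (x I : ℕ) = a := by
  rw [G.reaches_append h]
  refine and_congr_right fun _ => ⟨fun H => H I hg, fun H J hJ => ?_⟩
  have : J = I := Subtype.ext ((G.mem_infosetNodes.1 hJ).2.symm.trans (G.mem_infosetNodes.1 hg).2)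
  rw [this, H]

theorem reaches_congr {g h : List ℕ} {I : ℕ} (hg : g ∈ G.infosetNodes i I)
    (hh : h ∈ G.infosetNodes i I) (x : G.Pure i) : G.Reaches x g ↔ G.Reaches x h := by
  rw [G.reaches_iff (G.infosetNodes_subset_hist hg), G.reaches_iff (G.infosetNodes_subset_hist hh),
    G.sequence_eq hg hh]

theorem reachesSeq_iff {g : List ℕ} {I : G.infosets i} {a : ℕ} (hg : g ∈ G.infosetNodes i I)
    (ha : a ∈ G.infosetActions i (I : ℕ)) (x : G.Pure i) :
    G.ReachesSeq x I a ↔ G.Reaches x (g ++ [a]) := by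
  rw [G.reaches_append_of_mem ((G.append_mem_hist hg).2 ha) hg]
  constructor
  · rintro ⟨h, hh, H, e⟩
    exact ⟨(G.reaches_congr hh hg x).1 H, e⟩
  · rintro ⟨H, e⟩
    exact ⟨g, hg, H, e⟩

/-- Two strategies play to the same sequences of player `i` that start at nodes on the way to
`z`. -/
def AgreeAlong (x y : G.Pure i) (z : List ℕ) : Prop :=
  ∀ g a, g ∈ G.nodes i → g ++ [a] ∈ G.hist → g <+: z → g ≠ z →
    (G.Reaches x (g ++ [a]) ↔ G.Reaches y (g ++ [a]))

theorem AgreeAlong.reaches_iff {G : Game n} {x y : G.Pure i} {z : List ℕ}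
    (H : G.AgreeAlong x y z) (hz : z ∈ G.hist) : G.Reaches x z ↔ G.Reaches y z := by
  have key : ∀ x y : G.Pure i, G.AgreeAlong x y z → G.Reaches x z → G.Reaches y z := by
    intro x y H hx I g hg a hp
    have h1 := G.mem_hist_of_prefix hp hz
    have h2 := (H g a (G.mem_infosetNodes.1 hg).1 h1 ((List.prefix_append _ _).trans hp) (by
      rintro rfl; simpa using hp.length_le)).1 (hx.of_prefix hp)
    exact ((G.reaches_append_of_mem h1 hg y).1 h2).2
  exact ⟨key x y H, key y x fun g a h1 h2 h3 h4 => (H g a h1 h2 h3 h4).symm⟩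

open Classical in
/-- Expectations of quantities that depend only on the play along the way to `z` are determined
by the probabilities of playing to the histories. -/
theorem sum_eq_of_agreeAlong {ρ ρ' : G.Pure i → ℝ}
    (hρ : ∀ h ∈ G.hist, ∑ x, ρ x * (if G.Reaches x h then 1 else 0) =
      ∑ x, ρ' x * (if G.Reaches x h then 1 else 0))
    {z : List ℕ} (hz : z ∈ G.hist) (F : G.Pure i → ℝ)
    (hF : ∀ x y, G.AgreeAlong x y z → F x = F y) : ∑ x, ρ x * F x = ∑ x, ρ' x * F x := by
  induction z using List.reverseRecOn generalizing F with
  | nil =>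
    rcases isEmpty_or_nonempty (G.Pure i) with h | ⟨⟨x₀⟩⟩
    · simp
    · have hc : ∀ x, F x = F x₀ := fun x => hF x x₀ fun g a _ _ h h' =>
        absurd (List.prefix_nil.1 h) h'
      have := hρ [] hz
      simp only [G.reaches_nil, if_true, mul_one] at this
      simp only [hc, ← Finset.sum_mul, this]
  | append_singleton g a ih =>
    have hg := G.parent_mem _ _ hz
    by_cases hi : g ∈ G.nodes i
    · have hgI : g ∈ G.infosetNodes i (G.infoset g) := G.mem_infosetNodes.2 ⟨hi, rfl⟩
      let I : G.infosets i := ⟨G.infoset g, G.mem_infosets hgI⟩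
      have agree : ∀ x y : G.Pure i, G.AgreeAlong x y g → (∀ b, g ++ [b] ∈ G.hist →
          (G.Reaches x (g ++ [b]) ↔ G.Reaches y (g ++ [b]))) → G.AgreeAlong x y (g ++ [a]) := by
        intro x y h1 h2 g' b hg' hb hp hne
        rcases List.prefix_concat_iff.1 hp with h | h
        · exact absurd h hne
        · by_cases e : g' = g
          · subst e; exact h2 b hb
          · exact h1 g' b hg' hb h e
      -- the value of `F` on strategies that play to `g ++ [b]`
      have hval : ∀ b, g ++ [b] ∈ G.hist → ∃ c, ∀ x, G.Reaches x (g ++ [b]) → F x = c := by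
        intro b hb
        by_cases hex : ∃ x : G.Pure i, G.Reaches x (g ++ [b])
        · obtain ⟨x₀, h₀⟩ := hex
          have hx0 := (G.reaches_append_of_mem (I := I) hb hgI x₀).1 h₀
          refine ⟨F x₀, fun x hx => hF _ _ (agree _ _ ?_ ?_)⟩
          · have hx1 := (G.reaches_append_of_mem (I := I) hb hgI x).1 hx
            have aux : ∀ x y : G.Pure i, G.Reaches x g → G.Reaches y g → ∀ g' c, g' ∈ G.nodes i →
                g' ++ [c] ∈ G.hist → g' <+: g → g' ≠ g → G.Reaches x (g' ++ [c]) →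
                G.Reaches y (g' ++ [c]) := by
              intro x y hx hy g' c hg' hc hp hne hr
              have hg'I : g' ∈ G.infosetNodes i (G.infoset g') := G.mem_infosetNodes.2 ⟨hg', rfl⟩
              let I' : G.infosets i := ⟨G.infoset g', G.mem_infosets hg'I⟩
              obtain ⟨r, rfl⟩ := hp
              rcases r with _ | ⟨d, r⟩
              · simp at hne
              have h3 : g' ++ [d] <+: g' ++ d :: r := ⟨r, by simp⟩
              have h5 := (G.reaches_append_of_mem (I := I') hc hg'I x).1 hr
              have h6 := hx I' g' hg'I d h3
              rw [h5.2] at h6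
              rw [h6]
              exact hy.of_prefix h3
            exact fun g' c h1 h2 h3 h4 => ⟨aux _ _ hx1.1 hx0.1 g' c h1 h2 h3 h4,
              aux _ _ hx0.1 hx1.1 g' c h1 h2 h3 h4⟩
          · intro c hc
            have hx1 := (G.reaches_append_of_mem (I := I) hb hgI x).1 hx
            rw [G.reaches_append_of_mem (I := I) hc hgI, G.reaches_append_of_mem (I := I) hc hgI,
              hx1.2, hx0.2]
            simp [hx1.1, hx0.1]
        · exact ⟨0, fun x hx => absurd ⟨x, hx⟩ hex⟩
      choose! c hc using hval
      have split : ∀ x, F x = (if G.Reaches x g then 0 else F x) +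
          ∑ b ∈ G.actions g, c b * (if G.Reaches x (g ++ [b]) then 1 else 0) := by
        intro x
        by_cases hx : G.Reaches x g
        · have hxa : (x I : ℕ) ∈ G.actions g := by
            rw [← G.infosetActions_eq hgI]; exact (x I).2
          have hxh := (G.mem_actions g _).1 hxa
          rw [if_pos hx, zero_add, sum_eq_single_of_mem _ hxa]
          · have h2 := (G.reaches_append_of_mem (I := I) hxh hgI x).2 ⟨hx, rfl⟩
            rw [if_pos h2, mul_one, hc _ hxh x h2]
          · intro b hb hne
            rw [if_neg, mul_zero]
            rw [G.reaches_append_of_mem (I := I) ((G.mem_actions g b).1 hb) hgI]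
            exact fun h => hne h.2.symm
        · rw [if_neg hx, sum_eq_zero, add_zero]
          intro b _
          rw [if_neg, mul_zero]
          exact fun h => hx (h.of_prefix (List.prefix_append _ _))
      have h1 := ih hg (fun x => if G.Reaches x g then 0 else F x) (by
        intro x y hxy
        have hiff := hxy.reaches_iff hg
        by_cases hx : G.Reaches x g
        · simp [hx, hiff.1 hx]
        · have hy : ¬ G.Reaches y g := fun h => hx (hiff.2 h)
          simp only [hx, hy, if_false]
          refine hF x y (agree x y hxy fun b _ => ?_)
          exact ⟨fun h => absurd (h.of_prefix (List.prefix_append _ _)) hx,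
            fun h => absurd (h.of_prefix (List.prefix_append _ _)) hy⟩)
      have h2 : ∀ ρ : G.Pure i → ℝ, ∑ x, ρ x * F x =
          ∑ x, ρ x * (if G.Reaches x g then 0 else F x) +
          ∑ b ∈ G.actions g, c b * ∑ x, ρ x * (if G.Reaches x (g ++ [b]) then 1 else 0) := by
        intro ρ
        simp only [mul_sum]
        rw [sum_comm, ← sum_add_distrib]
        refine sum_congr rfl fun x _ => ?_
        nth_rw 1 [split x]
        rw [mul_add, mul_sum]
        congr 1
        exact sum_congr rfl fun b _ => by ring
      rw [h2 ρ, h2 ρ', h1]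
      congr 1
      exact sum_congr rfl fun b hb => by rw [hρ _ ((G.mem_actions g b).1 hb)]
    · refine ih hg F fun x y hxy => hF x y fun g' b hg' hb hp hne => ?_
      rcases List.prefix_concat_iff.1 hp with h | h
      · exact absurd h hne
      · refine hxy g' b hg' hb h ?_
        rintro rfl
        exact hi hg'

open Classical in
theorem sum_reaches_causal {ρ ρ' : G.Pure i → ℝ}
    (hρ : ∀ h ∈ G.hist, ∑ x, ρ x * (if G.Reaches x h then 1 else 0) =
      ∑ x, ρ' x * (if G.Reaches x h then 1 else 0))
    {φ : G.Pure i → G.Pure i} (hφ : G.IsCausal φ) {z : List ℕ} (hz : z ∈ G.hist) :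
    ∑ x, ρ x * (if G.Reaches (φ x) z then 1 else 0) =
      ∑ x, ρ' x * (if G.Reaches (φ x) z then 1 else 0) := by
  refine G.sum_eq_of_agreeAlong hρ hz _ fun x y hxy => ?_
  have key : ∀ (I : G.infosets i), ∀ g ∈ G.infosetNodes i I, g <+: z → g ≠ z → φ x I = φ y I := by
    intro I g hg hp hne
    refine hφ I x y ?_
    rintro J ⟨h, hh, g₁, hg₁, hp₁⟩ b hb
    -- a node of `J` on the way to `g`
    have hex : ∃ g₂ ∈ G.infosetNodes i J, g₂ <+: g := by
      obtain ⟨r, rfl⟩ := hp₁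
      rcases r with _ | ⟨d, r⟩
      · rw [List.append_nil] at hh
        refine ⟨g, ?_, List.prefix_refl _⟩
        rwa [← (G.mem_infosetNodes.1 hg₁).2, (G.mem_infosetNodes.1 hh).2]
      · have h1 : ((J : ℕ), d) ∈ G.sequence i (g₁ ++ d :: r) :=
          (G.mem_sequence (G.infosetNodes_subset_hist hh)).2 ⟨g₁, hg₁, r, by simp⟩
        rw [G.sequence_eq hh hg, G.mem_sequence (G.infosetNodes_subset_hist hg)] at h1
        obtain ⟨g₂, hg₂, hp₂⟩ := h1
        exact ⟨g₂, hg₂, (List.prefix_append _ _).trans hp₂⟩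
    obtain ⟨g₂, hg₂, hp₂⟩ := hex
    rw [G.reachesSeq_iff hg₂ hb, G.reachesSeq_iff hg₂ hb]
    refine hxy g₂ b (G.mem_infosetNodes.1 hg₂).1 ((G.append_mem_hist hg₂).2 hb) (hp₂.trans hp) ?_
    rintro rfl
    exact hne (hp.eq_of_length (le_antisymm hp.length_le hp₂.length_le))
  have h : G.Reaches (φ x) z ↔ G.Reaches (φ y) z := by
    refine forall_congr' fun I => forall_congr' fun g => forall_congr' fun hg =>
      forall_congr' fun a => forall_congr' fun hp => ?_
    rw [key I g hg ((List.prefix_append _ _).trans hp) (by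
      rintro rfl; simpa using hp.length_le)]
  simp only [h]

open Classical in
theorem sum_mixture_mul_reachProb {T : ℕ} (w : Fin T → ℝ)
    (σ : Fin T → (j : Fin n) → G.Pure j → ℝ) (ψ : (j : Fin n) → G.Pure j → G.Pure j)
    (z : List ℕ) :
    ∑ x, G.mixture w σ x * G.reachProb (fun j => ψ j (x j)) z =
      ∑ t, w t * (G.chanceReach z *
        ∏ j, ∑ y, σ t j y * (if G.Reaches (ψ j y) z then 1 else 0)) := by
  simp only [mixture, reachProb, Finset.sum_mul]
  rw [sum_comm]
  refine sum_congr rfl fun t _ => ?_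
  rw [Fintype.prod_sum, mul_sum, mul_sum]
  refine sum_congr rfl fun x _ => ?_
  rw [prod_mul_distrib]
  ring

open Classical in
theorem sum_mixture_congr {T : ℕ} (w : Fin T → ℝ) {σ σ' : Fin T → (j : Fin n) → G.Pure j → ℝ}
    {ψ : (j : Fin n) → G.Pure j → G.Pure j} {z : List ℕ}
    (h : ∀ t j, ∑ x, σ t j x * (if G.Reaches (ψ j x) z then 1 else 0) =
      ∑ x, σ' t j x * (if G.Reaches (ψ j x) z then 1 else 0)) :
    ∑ x, G.mixture w σ x * G.reachProb (fun j => ψ j (x j)) z =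
      ∑ x, G.mixture w σ' x * G.reachProb (fun j => ψ j (x j)) z := by
  simp only [sum_mixture_mul_reachProb, h]

open Classical in
theorem outcomeEquivalent_mixture {T : ℕ} (w : Fin T → ℝ)
    {σ σ' : Fin T → (j : Fin n) → G.Pure j → ℝ}
    (hσ : ∀ t j, ∀ h ∈ G.hist, ∑ x, σ t j x * (if G.Reaches x h then 1 else 0) =
      ∑ x, σ' t j x * (if G.Reaches x h then 1 else 0)) :
    G.OutcomeEquivalent (G.mixture w σ) (G.mixture w σ') := fun z hz =>
  G.sum_mixture_congr w (ψ := fun _ x => x) fun t j => hσ t j z (mem_filter.1 hz).1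

theorem sum_mul_utility (μ : G.Profile → ℝ) (f : G.Profile → G.Profile) :
    ∑ x, μ x * G.utility i (f x) =
      ∑ z ∈ G.terminals, (G.util i z).val * ∑ x, μ x * G.reachProb (f x) z := by
  simp only [utility, mul_sum]
  rw [sum_comm]
  exact sum_congr rfl fun z _ => sum_congr rfl fun x _ => by ring

open Classical in
/-- Mixtures of products whose factors play to every history with equal probabilities are
indistinguishable by causal deviations. -/
theorem regret_mixture {T : ℕ} (w : Fin T → ℝ) {σ σ' : Fin T → (j : Fin n) → G.Pure j → ℝ}
    (hσ : ∀ t j, ∀ h ∈ G.hist, ∑ x, σ t j x * (if G.Reaches x h then 1 else 0) =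
      ∑ x, σ' t j x * (if G.Reaches x h then 1 else 0))
    {φ : G.Pure i → G.Pure i} (hφ : G.IsCausal φ) :
    G.regret (G.mixture w σ) i φ = G.regret (G.mixture w σ') i φ := by
  have hupd : ∀ x : G.Profile, Function.update x i (φ (x i)) =
      fun j => Function.update (fun (j : Fin n) (y : G.Pure j) => y) i φ j (x j) := by
    intro x
    funext j
    by_cases hj : j = i
    · subst hj; simp
    · simp [Function.update_of_ne hj]
  simp only [regret, mul_sub, sum_sub_distrib]
  rw [sum_mul_utility, sum_mul_utility, sum_mul_utility, sum_mul_utility _ _ fun x => x]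
  congr 1 <;> refine sum_congr rfl fun z hz => ?_ <;> congr 1
  · simp only [hupd]
    refine G.sum_mixture_congr w fun t j => ?_
    by_cases hj : j = i
    · subst hj
      simpa using G.sum_reaches_causal (hσ t j) hφ (mem_filter.1 hz).1
    · simpa [Function.update_of_ne hj] using hσ t j z (mem_filter.1 hz).1
  · exact G.sum_mixture_congr w (ψ := fun _ x => x) fun t j => hσ t j z (mem_filter.1 hz).1

theorem mixture_mem_stdSimplex {T : ℕ} {w : Fin T → ℝ} {σ : Fin T → (j : Fin n) → G.Pure j → ℝ}
    (hw : ∀ t, 0 ≤ w t) (hw' : ∑ t, w t = 1) (hσ : ∀ t j x, 0 ≤ σ t j x)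
    (hσ' : ∀ t j, ∑ x, σ t j x = 1) : G.mixture w σ ∈ stdSimplex ℝ G.Profile := by
  refine ⟨fun x => sum_nonneg fun t _ => mul_nonneg (hw t) (prod_nonneg fun j _ => hσ t j _), ?_⟩
  simp only [mixture]
  rw [sum_comm]
  simp only [← mul_sum, ← Fintype.prod_sum, hσ', prod_const_one, mul_one, hw']

end Game

namespace List

theorem foldl_select_cases {α β : Type*} (l : List α) (c : α → Prop) [DecidablePred c] (f : α → β)
    (s : β) : ((∀ a ∈ l, ¬ c a) ∧ l.foldl (fun s a => if c a then f a else s) s = s) ∨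
      ∃ a ∈ l, c a ∧ l.foldl (fun s a => if c a then f a else s) s = f a := by
  induction l using List.reverseRecOn with
  | nil => simp
  | append_singleton l a ih =>
    rw [foldl_append, foldl_cons, foldl_nil]
    by_cases ha : c a
    · exact .inr ⟨a, by simp, ha, if_pos ha⟩
    · rw [if_neg ha]
      rcases ih with ⟨h1, h2⟩ | ⟨b, h1, h2⟩
      · refine .inl ⟨fun b hb => ?_, h2⟩
        rcases mem_append.1 hb with hb | hb
        · exact h1 b hb
        · rwa [mem_singleton.1 hb]
      · exact .inr ⟨b, by simp [h1], h2⟩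

/-- Selecting the last element with a property. -/
theorem foldl_select_last {α : Type*} [LinearOrder α] {l : List α} (hl : l.Pairwise (· < ·))
    {c : α → Prop} [DecidablePred c] (hc : ∃ a ∈ l, c a) (s : α) :
    c (l.foldl (fun s a => if c a then a else s) s) ∧
      ∀ a ∈ l, l.foldl (fun s a => if c a then a else s) s < a → ¬ c a := by
  induction l using List.reverseRecOn with
  | nil => simp at hc
  | append_singleton l a ih =>
    rw [foldl_append, foldl_cons, foldl_nil]
    obtain ⟨h1, -, h2⟩ := pairwise_append.1 hl
    by_cases ha : c a
    · simp only [ha, if_true, true_and]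
      intro b hb hab
      rcases mem_append.1 hb with hb | hb
      · exact absurd (h2 b hb a (by simp)) hab.asymm
      · rw [mem_singleton.1 hb] at hab
        exact absurd hab (lt_irrefl _)
    · rw [if_neg ha]
      obtain ⟨b, hb, hcb⟩ := hc
      have hbl : b ∈ l := by
        rcases mem_append.1 hb with hb | hb
        · exact hb
        · rw [mem_singleton.1 hb] at hcb; exact absurd hcb ha
      obtain ⟨h3, h4⟩ := ih h1 ⟨b, hbl, hcb⟩
      refine ⟨h3, fun d hd hlt => ?_⟩
      rcases mem_append.1 hd with hd | hd
      · exact h4 d hd hlt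
      · rwa [mem_singleton.1 hd]

end List

/-- In a partition of an interval into consecutive subintervals of widths `w`, the last subinterval
whose left end is at most `u` is the one that contains `u`. -/
theorem foldl_select_eq_iff {α : Type*} [Fintype α] [LinearOrder α] {w : α → ℤ}
    (hw : ∀ a, 0 ≤ w a) {L u : ℤ} (hL : L ≤ u) (hu : u < L + ∑ a, w a) (s a : α) :
    ((univ : Finset α).sort (· ≤ ·)).foldl
      (fun s a => if L + ∑ c with c < a, w c ≤ u then a else s) s = a ↔
      L + ∑ c with c < a, w c ≤ u ∧ u < L + ∑ c with c < a, w c + w a := by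
  have hne : (univ : Finset α).Nonempty := by
    by_contra h
    rw [not_nonempty_iff_eq_empty] at h
    rw [h] at hu
    simp at hu
    omega
  have hmin : ∃ a ∈ (univ : Finset α).sort (· ≤ ·), L + ∑ c with c < a, w c ≤ u := by
    refine ⟨univ.min' hne, by simp, ?_⟩
    rw [filter_false_of_mem fun c _ => not_lt.2 (min'_le _ _ (mem_univ _))]
    simpa using hL
  obtain ⟨h1, h2⟩ := List.foldl_select_last (univ : Finset α).sortedLT_sort.pairwise hmin s
  set r := ((univ : Finset α).sort (· ≤ ·)).foldl
    (fun s a => if L + ∑ c with c < a, w c ≤ u then a else s) s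
  have hle : ∀ a b : α, a < b → ∑ c with c < a, w c + w a ≤ ∑ c with c < b, w c := by
    intro a b hab
    have : insert a (univ.filter (· < a)) ⊆ univ.filter (· < b) := by
      intro c hc
      rcases mem_insert.1 hc with rfl | hc
      · simpa using hab
      · simp at hc ⊢; exact hc.trans hab
    have h := sum_le_sum_of_subset_of_nonneg this fun c _ _ => hw c
    rw [sum_insert (by simp)] at h
    linarith
  constructor
  · intro e
    rw [← e]
    refine ⟨h1, ?_⟩
    by_contra hcon
    rw [not_lt] at hcon
    by_cases hr : (univ.filter (r < ·)).Nonempty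
    · obtain ⟨m, hm, hmin⟩ := exists_min_image _ (fun a : α => a) hr
      simp only [mem_filter, mem_univ, true_and] at hm hmin
      refine h2 m (by simp) hm ?_
      have : univ.filter (· < m) = insert r (univ.filter (· < r)) := by
        ext c
        simp only [mem_filter, mem_univ, true_and, mem_insert]
        constructor
        · intro hc
          rcases lt_trichotomy c r with h | h | h
          · exact .inr h
          · exact .inl h
          · exact absurd (hmin c h) (not_le.2 hc)
        · rintro (rfl | h)
          · exact hm
          · exact h.trans hm
      rw [this, sum_insert (by simp)]
      linarith
    · have : (univ : Finset α) = insert r (univ.filter (· < r)) := by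
        ext c
        simp only [mem_univ, true_iff, mem_insert, mem_filter, true_and]
        by_contra h
        push Not at h
        exact hr ⟨c, by simpa using lt_of_le_of_ne h.2 (Ne.symm h.1)⟩
      rw [this, sum_insert (by simp)] at hu
      linarith
  · rintro ⟨h3, h4⟩
    rcases lt_trichotomy r a with h | h | h
    · exact absurd h3 (h2 a (by simp) h)
    · exact h
    · have := hle a r h
      linarith

theorem sum_filter_lt_add_le {α : Type*} [Fintype α] [LinearOrder α] {w : α → ℤ}
    (hw : ∀ a, 0 ≤ w a) (a : α) : ∑ c with c < a, w c + w a ≤ ∑ c, w c := by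
  rw [add_comm, ← sum_insert (f := w) (by simp)]
  exact sum_le_sum_of_subset_of_nonneg (subset_univ _) fun c _ _ => hw c

namespace Game

variable {n : ℕ} (G : Game n)

/-- Probabilities of the actions at the information sets of player `i`. -/
abbrev ActionProbs (i : Fin n) : Type :=
  (I : G.infosets i) → G.infosetActions i (I : ℕ) → Frac

/-- The information sets and actions of player `i` on the way to `h`. -/
def pathSet (i : Fin n) (h : List ℕ) : Set (ℕ × ℕ) := {p | p ∈ G.sequence i h}

/-- The information sets and actions of player `i` on the way to the information set `J`, followed
by the action `a` at `J`. -/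
def seqSet (i : Fin n) (J a : ℕ) : Set (ℕ × ℕ) :=
  {p | p = (J, a) ∨ ∃ g ∈ G.infosetNodes i J, p ∈ G.sequence i g}

variable {i : Fin n} {G}

theorem pathSet_nil : G.pathSet i [] = ∅ := by
  ext ⟨J, b⟩
  simp [pathSet, G.mem_sequence G.root_mem]

theorem seqSet_eq {g : List ℕ} {I a : ℕ} (hg : g ∈ G.infosetNodes i I) :
    G.seqSet i I a = insert (I, a) (G.pathSet i g) := by
  ext p
  refine or_congr_right ⟨?_, fun h => ⟨g, hg, h⟩⟩
  rintro ⟨g', hg', hp⟩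
  rwa [G.sequence_eq hg' hg] at hp

theorem notMem_pathSet {g : List ℕ} {I : ℕ} (hg : g ∈ G.infosetNodes i I) (a : ℕ) :
    (I, a) ∉ G.pathSet i g := G.notMem_sequence hg

theorem pathSet_append_of_mem {g : List ℕ} {I a : ℕ} (hg : g ∈ G.infosetNodes i I)
    (h : g ++ [a] ∈ G.hist) : G.pathSet i (g ++ [a]) = G.seqSet i I a := by
  rw [seqSet_eq hg]
  ext ⟨J, b⟩
  simp only [pathSet, Set.mem_ofPred_eq, G.mem_sequence_append h, Set.mem_insert_iff, Prod.mk.injEq,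
    (G.mem_infosetNodes.1 hg).1, G.mem_infosetNodes, true_and, (G.mem_infosetNodes.1 hg).2]
  rw [or_comm, eq_comm (a := I), eq_comm (a := a)]

theorem pathSet_append_of_notMem {g : List ℕ} {a : ℕ} (hg : g ∉ G.nodes i)
    (h : g ++ [a] ∈ G.hist) : G.pathSet i (g ++ [a]) = G.pathSet i g := by
  ext ⟨J, b⟩
  simp [pathSet, G.mem_sequence_append h, G.mem_infosetNodes, hg]

variable (b : G.ActionProbs i)

open Classical in
/-- The probability of playing the actions in `S`, times the product of all denominators. -/
noncomputable def width (S : Set (ℕ × ℕ)) : ℤ :=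
  ∏ J : G.infosets i, ∏ a : G.infosetActions i (J : ℕ),
    if ((J : ℕ), (a : ℕ)) ∈ S then (b J a).num else (b J a).den

/-- The product of all denominators. -/
def totalDen : ℕ := ∏ J, ∏ a, (b J a).den

open Classical in
/-- The left end of the interval of widths assigned to the set `S` of actions. -/
noncomputable def left (S : Set (ℕ × ℕ)) : ℤ :=
  ∑ J : G.infosets i, ∑ a : G.infosetActions i (J : ℕ), ∑ a' : G.infosetActions i (J : ℕ),
    if a' < a ∧ ((J : ℕ), (a : ℕ)) ∈ S then width b (G.seqSet i J a') else 0

open Classical in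
/-- The probability of playing the actions in `S`. -/
noncomputable def playProb (S : Set (ℕ × ℕ)) : ℝ :=
  ∏ J : G.infosets i, ∏ a : G.infosetActions i (J : ℕ),
    if ((J : ℕ), (a : ℕ)) ∈ S then (b J a).val else 1

theorem totalDen_pos : 0 < totalDen b :=
  prod_pos fun J _ => prod_pos fun a _ => (b J a).den_pos

theorem width_empty : width b ∅ = totalDen b := by simp [width, totalDen]

theorem width_eq (S : Set (ℕ × ℕ)) : (width b S : ℝ) = totalDen b * playProb b S := by
  simp only [width, totalDen, playProb, Int.cast_prod, Nat.cast_prod, ← prod_mul_distrib]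
  refine prod_congr rfl fun J _ => prod_congr rfl fun a _ => ?_
  have : ((b J a).den : ℝ) ≠ 0 := by exact_mod_cast (b J a).den_pos.ne'
  split_ifs
  · rw [Frac.val]; field_simp
  · simp

theorem playProb_insert {S : Set (ℕ × ℕ)} (I : G.infosets i) (a : G.infosetActions i (I : ℕ))
    (h : ((I : ℕ), (a : ℕ)) ∉ S) :
    playProb b (insert ((I : ℕ), (a : ℕ)) S) = (b I a).val * playProb b S := by
  classical
  obtain ⟨S', hS'⟩ : ∃ S', S' = insert ((I : ℕ), (a : ℕ)) S := ⟨_, rfl⟩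
  rw [← hS']
  have key : ∀ (J : G.infosets i) (c : G.infosetActions i (J : ℕ)),
      (if ((J : ℕ), (c : ℕ)) ∈ S' then (b J c).val else 1) =
      (if (⟨J, c⟩ : Σ J : G.infosets i, G.infosetActions i (J : ℕ)) = ⟨I, a⟩ then (b I a).val
        else 1) * (if ((J : ℕ), (c : ℕ)) ∈ S then (b J c).val else 1) := by
    intro J c
    by_cases hJ : (⟨J, c⟩ : Σ J : G.infosets i, G.infosetActions i (J : ℕ)) = ⟨I, a⟩
    · obtain ⟨rfl, h2⟩ := Sigma.mk.inj_iff.1 hJ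
      obtain rfl := eq_of_heq h2
      simp [h, hS']
    · have : ((J : ℕ), (c : ℕ)) ≠ ((I : ℕ), (a : ℕ)) := by
        intro e
        obtain ⟨e1, e2⟩ := Prod.ext_iff.1 e
        obtain rfl := Subtype.ext e1
        obtain rfl := Subtype.ext e2
        exact hJ rfl
      simp [hJ, hS', this]
  simp only [playProb, key, prod_mul_distrib]
  congr 1
  rw [prod_sigma', univ_sigma_univ]
  exact (prod_ite_eq' univ (⟨I, a⟩ : Σ J : G.infosets i, G.infosetActions i (J : ℕ))
    fun _ => (b I a).val).trans (by simp)

theorem left_empty : left b ∅ = 0 := by simp [left]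

theorem left_insert {S : Set (ℕ × ℕ)} (I : G.infosets i) (a : G.infosetActions i (I : ℕ))
    (h : ((I : ℕ), (a : ℕ)) ∉ S) :
    left b (insert ((I : ℕ), (a : ℕ)) S) =
      left b S + ∑ a' with a' < a, width b (G.seqSet i I a') := by
  classical
  obtain ⟨S', hS'⟩ : ∃ S', S' = insert ((I : ℕ), (a : ℕ)) S := ⟨_, rfl⟩
  rw [← hS']
  have key : ∀ (J : G.infosets i) (c : G.infosetActions i (J : ℕ)),
      (∑ a' : G.infosetActions i (J : ℕ),
      if a' < c ∧ ((J : ℕ), (c : ℕ)) ∈ S'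
        then width b (G.seqSet i J a') else 0) =
      (∑ a' : G.infosetActions i (J : ℕ),
        if a' < c ∧ ((J : ℕ), (c : ℕ)) ∈ S then width b (G.seqSet i J a') else 0) +
      (if (⟨J, c⟩ : Σ J : G.infosets i, G.infosetActions i (J : ℕ)) = ⟨I, a⟩ then
        ∑ a' with a' < a, width b (G.seqSet i I a') else 0) := by
    intro J c
    by_cases hJ : (⟨J, c⟩ : Σ J : G.infosets i, G.infosetActions i (J : ℕ)) = ⟨I, a⟩
    · obtain ⟨rfl, h2⟩ := Sigma.mk.inj_iff.1 hJ
      obtain rfl := eq_of_heq h2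
      simp [h, hS', sum_filter]
    · have : ((J : ℕ), (c : ℕ)) ≠ ((I : ℕ), (a : ℕ)) := by
        intro e
        obtain ⟨e1, e2⟩ := Prod.ext_iff.1 e
        obtain rfl := Subtype.ext e1
        obtain rfl := Subtype.ext e2
        exact hJ rfl
      simp [hJ, hS', this]
  simp only [left, key, sum_add_distrib]
  congr 1
  rw [sum_sigma', univ_sigma_univ]
  exact (sum_ite_eq' univ (⟨I, a⟩ : Σ J : G.infosets i, G.infosetActions i (J : ℕ))
    fun _ => ∑ a' with a' < a, width b (G.seqSet i I a')).trans (by simp)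

variable {b}

theorem width_nonneg (hb : ∀ I a, 0 ≤ (b I a).val) (S : Set (ℕ × ℕ)) : 0 ≤ width b S := by
  have h : (0 : ℝ) ≤ width b S := by
    rw [width_eq]
    refine mul_nonneg (Nat.cast_nonneg _) (prod_nonneg fun J _ => prod_nonneg fun a _ => ?_)
    split_ifs
    · exact hb J a
    · exact zero_le_one
  exact_mod_cast h

theorem sum_width_seqSet (hb' : ∀ I, ∑ a, (b I a).val = 1) {g : List ℕ} (I : G.infosets i)
    (hg : g ∈ G.infosetNodes i I) :
    ∑ a : G.infosetActions i (I : ℕ), width b (G.seqSet i I a) = width b (G.pathSet i g) := by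
  have h : (∑ a : G.infosetActions i (I : ℕ), width b (G.seqSet i I a) : ℝ) =
      width b (G.pathSet i g) := by
    rw [width_eq]
    simp only [width_eq, seqSet_eq hg]
    rw [← mul_sum]
    congr 1
    simp only [fun a => playProb_insert b I a (notMem_pathSet hg a)]
    rw [← sum_mul, hb', one_mul]
  exact_mod_cast h

theorem left_seqSet {g : List ℕ} (I : G.infosets i) (hg : g ∈ G.infosetNodes i I)
    (a : G.infosetActions i (I : ℕ)) : left b (G.seqSet i I a) =
      left b (G.pathSet i g) + ∑ a' with a' < a, width b (G.seqSet i I a') := by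
  rw [seqSet_eq hg, left_insert b I a (notMem_pathSet hg a)]

theorem left_nonneg (hb : ∀ I a, 0 ≤ (b I a).val) (S : Set (ℕ × ℕ)) : 0 ≤ left b S := by
  refine sum_nonneg fun J _ => sum_nonneg fun a _ => sum_nonneg fun a' _ => ?_
  split_ifs
  · exact width_nonneg hb _
  · exact le_rfl

theorem left_add_width_le (hb : ∀ I a, 0 ≤ (b I a).val) (hb' : ∀ I, ∑ a, (b I a).val = 1)
    {h : List ℕ} (hh : h ∈ G.hist) :
    left b (G.pathSet i h) + width b (G.pathSet i h) ≤ totalDen b := by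
  induction h using List.reverseRecOn with
  | nil => rw [pathSet_nil, left_empty, width_empty, zero_add]
  | append_singleton g a ih =>
    have ih := ih (G.parent_mem _ _ hh)
    by_cases hg : g ∈ G.nodes i
    · have hgI : g ∈ G.infosetNodes i (G.infoset g) := G.mem_infosetNodes.2 ⟨hg, rfl⟩
      let I : G.infosets i := ⟨G.infoset g, G.mem_infosets hgI⟩
      let a' : G.infosetActions i (I : ℕ) := ⟨a, (G.append_mem_hist hgI).1 hh⟩
      rw [pathSet_append_of_mem hgI hh]
      have h1 := left_seqSet (b := b) I hgI a'
      have h2 : ∑ c with c < a', width b (G.seqSet i I c) + width b (G.seqSet i I a') ≤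
          width b (G.pathSet i g) := by
        rw [← sum_width_seqSet hb' I hgI]
        exact sum_filter_lt_add_le (fun c => width_nonneg hb _) a'
      simp only [I, a'] at h1 h2
      linarith
    · rwa [pathSet_append_of_notMem hg hh]

variable (b)

theorem sort_infosetActions_ne_nil (I : G.infosets i) :
    (univ : Finset (G.infosetActions i (I : ℕ))).sort (· ≤ ·) ≠ [] := by
  obtain ⟨a, ha⟩ := G.infosetActions_nonempty I
  exact List.ne_nil_of_mem (a := ⟨a, ha⟩) (by simp)

open Classical in
/-- The pure strategy that takes, at each information set, the last action whose interval begins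
at `u` or before. -/
noncomputable def quantileStrat (u : ℤ) : G.Pure i := fun I =>
  ((univ : Finset (G.infosetActions i (I : ℕ))).sort (· ≤ ·)).foldl
    (fun (s a : G.infosetActions i (I : ℕ)) => if left b (G.seqSet i I a) ≤ u then a else s)
    (((univ : Finset (G.infosetActions i (I : ℕ))).sort (· ≤ ·)).head
      (sort_infosetActions_ne_nil I))

variable {b}

theorem reaches_quantileStrat (hb : ∀ I a, 0 ≤ (b I a).val) (hb' : ∀ I, ∑ a, (b I a).val = 1)
    {u : ℤ} (hu : 0 ≤ u) (hu' : u < totalDen b) {h : List ℕ} (hh : h ∈ G.hist) :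
    G.Reaches (quantileStrat b u) h ↔ left b (G.pathSet i h) ≤ u ∧
      u < left b (G.pathSet i h) + width b (G.pathSet i h) := by
  induction h using List.reverseRecOn with
  | nil => simp [pathSet_nil, left_empty, width_empty, hu, hu', G.reaches_nil]
  | append_singleton g a ih =>
    have ih := ih (G.parent_mem _ _ hh)
    by_cases hg : g ∈ G.nodes i
    · have hgI : g ∈ G.infosetNodes i (G.infoset g) := G.mem_infosetNodes.2 ⟨hg, rfl⟩
      let I : G.infosets i := ⟨G.infoset g, G.mem_infosets hgI⟩
      let a' : G.infosetActions i (I : ℕ) := ⟨a, (G.append_mem_hist hgI).1 hh⟩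
      have h1 := left_seqSet (b := b) I hgI a'
      have h2 := sum_width_seqSet hb' I hgI
      rw [G.reaches_append_of_mem (I := I) hh hgI, ih, pathSet_append_of_mem hgI hh]
      change _ ∧ (quantileStrat b u I : ℕ) = (a' : ℕ) ↔ left b (G.seqSet i I a') ≤ u ∧
        u < left b (G.seqSet i I a') + width b (G.seqSet i I a')
      rw [← Subtype.ext_iff, h1]
      by_cases hin : left b (G.pathSet i g) ≤ u ∧
        u < left b (G.pathSet i g) + width b (G.pathSet i g)
      · rw [and_iff_right hin, ← foldl_select_eq_iff
          (fun c : G.infosetActions i (I : ℕ) => width_nonneg hb (G.seqSet i I c))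
          hin.1 (by rw [h2]; exact hin.2)
          (((univ : Finset (G.infosetActions i (I : ℕ))).sort (· ≤ ·)).head
            (sort_infosetActions_ne_nil I)) a']
        simp only [quantileStrat, left_seqSet I hgI]
      · refine iff_of_false (fun h => hin h.1) ?_
        rintro ⟨h3, h4⟩
        have h5 : ∑ c with c < a', width b (G.seqSet i I c) + width b (G.seqSet i I a') ≤
            width b (G.pathSet i g) := by
          rw [← h2]
          exact sum_filter_lt_add_le (fun c => width_nonneg hb _) a'
        have h6 : 0 ≤ ∑ c with c < a', width b (G.seqSet i I c) :=
          sum_nonneg fun c _ => width_nonneg hb _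
        exact hin ⟨by linarith, by linarith⟩
    · rw [pathSet_append_of_notMem hg hh, G.reaches_append_of_notMem hh hg, ih]

open Classical in
theorem sum_reaches_quantileStrat (hb : ∀ I a, 0 ≤ (b I a).val)
    (hb' : ∀ I, ∑ a, (b I a).val = 1) {h : List ℕ} (hh : h ∈ G.hist) :
    ∑ u ∈ Ico (0 : ℤ) (totalDen b), (if G.Reaches (quantileStrat b u) h then (1 : ℝ) else 0) =
      width b (G.pathSet i h) := by
  have h1 := left_nonneg hb (G.pathSet i h)
  have h2 := left_add_width_le hb hb' hh
  have h3 := width_nonneg hb (G.pathSet i h)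
  rw [sum_boole]
  have : (Ico (0 : ℤ) (totalDen b)).filter (fun u => G.Reaches (quantileStrat b u) h) =
      Ico (left b (G.pathSet i h)) (left b (G.pathSet i h) + width b (G.pathSet i h)) := by
    ext u
    simp only [mem_filter, mem_Ico]
    constructor
    · rintro ⟨⟨h4, h5⟩, h6⟩
      exact (reaches_quantileStrat hb hb' h4 h5 hh).1 h6
    · rintro ⟨h4, h5⟩
      exact ⟨⟨by omega, by omega⟩,
        (reaches_quantileStrat hb hb' (by omega) (by omega) hh).2 ⟨h4, h5⟩⟩
  rw [this, Int.card_Ico, add_sub_cancel_left]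
  exact_mod_cast congrArg (Int.cast : ℤ → ℝ) (Int.toNat_of_nonneg h3)

open Classical in
/-- The probability of playing to a history under a behavior strategy. -/
theorem sum_prod_mul_reaches (hb' : ∀ I, ∑ a, (b I a).val = 1) {h : List ℕ} (hh : h ∈ G.hist) :
    ∑ x : G.Pure i, (∏ I, (b I (x I)).val) * (if G.Reaches x h then (1 : ℝ) else 0) =
      playProb b (G.pathSet i h) := by
  have h1 : ∀ x : G.Pure i, (∏ I, (b I (x I)).val) * (if G.Reaches x h then (1 : ℝ) else 0) =
      ∏ I, (b I (x I)).val *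
        (if ∀ a, ((I : ℕ), a) ∈ G.sequence i h → (x I : ℕ) = a then 1 else 0) := by
    intro x
    rw [prod_mul_distrib, G.reaches_iff hh, prod_ite_zero]
    simp
  simp only [h1]
  rw [← Fintype.prod_sum (fun (I : G.infosets i) (c : G.infosetActions i (I : ℕ)) => (b I c).val *
    (if ∀ a, ((I : ℕ), a) ∈ G.sequence i h → (c : ℕ) = a then (1 : ℝ) else 0))]
  refine prod_congr rfl fun I _ => ?_
  by_cases hex : ∃ a : G.infosetActions i (I : ℕ), ((I : ℕ), (a : ℕ)) ∈ G.sequence i h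
  · obtain ⟨a, ha⟩ := hex
    have huniq : ∀ c, ((I : ℕ), c) ∈ G.sequence i h → (a : ℕ) = c := by
      intro c hc
      obtain ⟨g, hg, hp⟩ := (G.mem_sequence hh).1 ha
      obtain ⟨g', hg', hp'⟩ := (G.mem_sequence hh).1 hc
      have key : ∀ g g' : List ℕ, ∀ a c : ℕ, g ∈ G.infosetNodes i I → g' ∈ G.infosetNodes i I →
          g ++ [a] <+: h → g' ++ [c] <+: h → ¬ g.length < g'.length := by
        intro g g' a c hg hg' hp hp' hlt
        refine G.notMem_sequence (a := a) hg' ?_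
        rw [G.mem_sequence (G.infosetNodes_subset_hist hg')]
        refine ⟨g, hg, List.prefix_of_prefix_length_le hp ((List.prefix_append _ _).trans hp') ?_⟩
        simpa using hlt
      have hlen : g.length = g'.length :=
        le_antisymm (not_lt.1 (key _ _ _ _ hg' hg hp' hp)) (not_lt.1 (key _ _ _ _ hg hg' hp hp'))
      have e := (List.prefix_of_prefix_length_le hp hp' (by simp [hlen])).eq_of_length
        (by simp [hlen])
      simpa using (List.append_inj' e rfl).2
    rw [sum_eq_single_of_mem a (mem_univ _), prod_eq_single_of_mem a (mem_univ _)]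
    · rw [if_pos huniq, mul_one, if_pos (by exact ha)]
    · intro c _ hne
      rw [if_neg]
      exact fun hc => hne (Subtype.ext (huniq c hc).symm)
    · intro c _ hne
      rw [if_neg, mul_zero]
      exact fun hc => hne (Subtype.ext (hc a ha))
  · have h2 : ∀ c, ((I : ℕ), c) ∉ G.sequence i h := by
      intro c hc
      obtain ⟨g, hg, hp⟩ := (G.mem_sequence hh).1 hc
      exact hex ⟨⟨c, (G.append_mem_hist hg).1 (G.mem_hist_of_prefix hp hh)⟩, hc⟩
    simp only [h2, false_imp_iff, implies_true, if_true, mul_one, hb']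
    rw [prod_eq_one]
    intro a _
    rw [if_neg]
    exact h2 a

end Game

/-- Summation of a function that is constant between consecutive breakpoints. -/
theorem sum_Ico_eq_sum_breakpoints {V : Finset ℤ} {D : ℤ} (h0 : 0 ∈ V) (hV : ∀ v ∈ V, 0 ≤ v)
    {next : ℤ → ℤ} (hD : ∀ v ∈ V, v ≤ next v ∧ next v ≤ D)
    (hn : ∀ v ∈ V, next v = D ∨ next v ∈ V ∧ v < next v)
    (hmin : ∀ v ∈ V, ∀ v' ∈ V, v < v' → next v ≤ v') {f : ℤ → ℝ}
    (hf : ∀ v ∈ V, ∀ u, v ≤ u → u < next v → f u = f v) :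
    ∑ u ∈ Ico 0 D, f u = ∑ v ∈ V, ((next v - v : ℤ) : ℝ) * f v := by
  have hunion : Ico 0 D = V.biUnion fun v => Ico v (next v) := by
    ext u
    simp only [mem_Ico, mem_biUnion]
    constructor
    · rintro ⟨h1, h2⟩
      obtain ⟨v, hv, hmax⟩ := exists_max_image (V.filter (· ≤ u)) (fun v => v)
        ⟨0, mem_filter.2 ⟨h0, h1⟩⟩
      obtain ⟨hvV, hvu⟩ := mem_filter.1 hv
      refine ⟨v, hvV, hvu, ?_⟩
      rcases hn v hvV with h | ⟨h3, h4⟩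
      · omega
      · by_contra h5
        have := hmax _ (mem_filter.2 ⟨h3, not_lt.1 h5⟩)
        omega
    · rintro ⟨v, hv, h1, h2⟩
      have := hV v hv
      have := hD v hv
      omega
  rw [hunion, sum_biUnion]
  · refine sum_congr rfl fun v hv => ?_
    rw [sum_congr rfl fun u hu => hf v hv u (mem_Ico.1 hu).1 (mem_Ico.1 hu).2, sum_const,
      Int.card_Ico, nsmul_eq_mul]
    congr 1
    exact_mod_cast congrArg (Int.cast : ℤ → ℝ)
      (Int.toNat_of_nonneg (sub_nonneg.2 (hD v hv).1))
  · intro v hv v' hv' hne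
    refine disjoint_left.2 fun u hu hu' => ?_
    rw [mem_Ico] at hu hu'
    rcases lt_or_gt_of_ne hne with h | h
    · have := hmin v hv v' hv' h
      omega
    · have := hmin v' hv' v hv h
      omega

namespace Game

variable {n : ℕ} {G : Game n} {i : Fin n} (b : G.ActionProbs i)

/-- The left end of the interval of the history `h`. -/
noncomputable def leftAt (h : List ℕ) : ℤ := left b (G.pathSet i h)

/-- The left end of the interval of `h` is the smallest one above `v`. -/
def IsNext (v : ℤ) (h : G.hist) : Prop :=
  v < leftAt b h ∧ ¬ ∃ h' : G.hist, v < leftAt b h' ∧ leftAt b h' < leftAt b h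

open Classical in
/-- The smallest left end of an interval above `v`, or the total width. -/
noncomputable def nextLeft (v : ℤ) : ℤ :=
  ((univ : Finset G.hist).sort (· ≤ ·)).foldl
    (fun s h => if IsNext b v h then leftAt b h else s) (totalDen b)

/-- The number of histories with left end `v`. -/
noncomputable def multiplicity (v : ℤ) : ℕ := #{h : G.hist | leftAt b h = v}

/-- The coefficient of the pure strategy of the history `h`. -/
noncomputable def quantileCoeff (h : G.hist) : Frac where
  num := nextLeft b (leftAt b h) - leftAt b h
  den := totalDen b * multiplicity b (leftAt b h)
  den_pos := Nat.mul_pos (totalDen_pos b) (card_pos.2 ⟨h, by simp⟩)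

variable {b}

theorem nextLeft_le_of_lt {v : ℤ} {h : List ℕ} (hh : h ∈ G.hist) (hv : v < leftAt b h) :
    nextLeft b v ≤ leftAt b h := by
  classical
  obtain ⟨m, hm, hmin⟩ := exists_min_image
    ((univ : Finset G.hist).filter fun h : G.hist => v < leftAt b h)
    (fun h : G.hist => leftAt b h) ⟨⟨h, hh⟩, by simpa using hv⟩
  rw [mem_filter] at hm
  have hmin' : ¬ ∃ h' : G.hist, v < leftAt b h' ∧ leftAt b h' < leftAt b m := by
    rintro ⟨h', h1, h2⟩
    exact absurd (hmin h' (by simpa using h1)) (not_le.2 h2)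
  rcases List.foldl_select_cases ((univ : Finset G.hist).sort (· ≤ ·)) (IsNext b v)
    (fun h : G.hist => leftAt b h) (totalDen b : ℤ) with ⟨h1, -⟩ | ⟨a, -, ⟨-, h2⟩, h3⟩
  · exact absurd ⟨hm.2, hmin'⟩ (h1 m (by simp))
  · rw [nextLeft, h3]
    by_contra hlt
    exact h2 ⟨⟨h, hh⟩, hv, not_le.1 hlt⟩

theorem nextLeft_cases (v : ℤ) :
    nextLeft b v = totalDen b ∨ ∃ h : G.hist, nextLeft b v = leftAt b h ∧ v < leftAt b h := by
  classical
  rcases List.foldl_select_cases ((univ : Finset G.hist).sort (· ≤ ·)) (IsNext b v)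
    (fun h : G.hist => leftAt b h) (totalDen b : ℤ) with ⟨-, h⟩ | ⟨a, -, ⟨h1, -⟩, h3⟩
  · exact .inl h
  · exact .inr ⟨a, h3, h1⟩

theorem quantileStrat_congr {u v : ℤ} (hvu : v ≤ u) (hu : u < nextLeft b v) :
    quantileStrat b u = quantileStrat b v := by
  funext I
  have key : ∀ a : G.infosetActions i (I : ℕ),
      left b (G.seqSet i I a) ≤ u ↔ left b (G.seqSet i I a) ≤ v := by
    intro a
    refine ⟨fun h => ?_, fun h => h.trans hvu⟩
    by_contra hlt
    obtain ⟨g, hg⟩ := G.exists_infosetNode I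
    have hh := (G.append_mem_hist hg).2 a.2
    have h1 := nextLeft_le_of_lt (b := b) (v := v) hh
    rw [leftAt, pathSet_append_of_mem hg hh] at h1
    have := h1 (not_le.1 hlt)
    omega
  simp only [quantileStrat, key]

theorem leftAt_le (hb : ∀ I a, 0 ≤ (b I a).val) (hb' : ∀ I, ∑ a, (b I a).val = 1) (h : G.hist) :
    leftAt b h ≤ totalDen b := by
  have h1 := left_add_width_le hb hb' h.2
  have h2 := width_nonneg hb (G.pathSet i h)
  rw [leftAt]
  omega

theorem leftAt_le_nextLeft (hb : ∀ I a, 0 ≤ (b I a).val) (hb' : ∀ I, ∑ a, (b I a).val = 1)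
    (h : G.hist) : leftAt b h ≤ nextLeft b (leftAt b h) := by
  rcases nextLeft_cases (b := b) (leftAt b h) with h' | ⟨h', h1, h2⟩
  · rw [h']; exact leftAt_le hb hb' h
  · rw [h1]; exact h2.le

theorem quantileCoeff_nonneg (hb : ∀ I a, 0 ≤ (b I a).val) (hb' : ∀ I, ∑ a, (b I a).val = 1)
    (h : G.hist) : 0 ≤ (quantileCoeff b h).val := by
  refine div_nonneg ?_ (Nat.cast_nonneg _)
  exact_mod_cast sub_nonneg.2 (leftAt_le_nextLeft hb hb' h)

/-- The mixture of the quantile strategies is the distribution of the quantile strategy at a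
uniformly random point. -/
theorem sum_quantileCoeff_mul (hb : ∀ I a, 0 ≤ (b I a).val) (hb' : ∀ I, ∑ a, (b I a).val = 1)
    (F : G.Pure i → ℝ) :
    ∑ h, (quantileCoeff b h).val * F (quantileStrat b (leftAt b h)) =
      (∑ u ∈ Ico (0 : ℤ) (totalDen b), F (quantileStrat b u)) / totalDen b := by
  have h1 := sum_Ico_eq_sum_breakpoints (V := univ.image fun h : G.hist => leftAt b h)
    (D := totalDen b) (next := nextLeft b) (f := fun u => F (quantileStrat b u))
    (mem_image.2 ⟨⟨[], G.root_mem⟩, mem_univ _, by simp [leftAt, pathSet_nil, left_empty]⟩)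
    (by
      simp only [mem_image, mem_univ, true_and, forall_exists_index, forall_apply_eq_imp_iff]
      exact fun h => left_nonneg hb _)
    (by
      simp only [mem_image, mem_univ, true_and, forall_exists_index, forall_apply_eq_imp_iff]
      refine fun h => ⟨leftAt_le_nextLeft hb hb' h, ?_⟩
      rcases nextLeft_cases (b := b) (leftAt b h) with h' | ⟨h', h1, h2⟩
      · exact h'.le
      · rw [h1]; exact leftAt_le hb hb' h')
    (by
      intro v _
      rcases nextLeft_cases (b := b) v with h' | ⟨h', h1, h2⟩
      · exact .inl h'
      · exact .inr ⟨mem_image.2 ⟨h', mem_univ _, h1.symm⟩, by omega⟩)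
    (by
      simp only [mem_image, mem_univ, true_and, forall_exists_index, forall_apply_eq_imp_iff]
      exact fun h h' hlt => nextLeft_le_of_lt h'.2 hlt)
    (fun v _ u h1 h2 => by rw [quantileStrat_congr h1 h2])
  rw [h1, sum_div]
  have hD : (totalDen b : ℝ) ≠ 0 := by exact_mod_cast (totalDen_pos b).ne'
  have h2 := sum_comp (s := (univ : Finset G.hist)) (fun v : ℤ => ((nextLeft b v - v : ℤ) : ℝ) /
    ((totalDen b * multiplicity b v : ℕ) : ℝ) * F (quantileStrat b v)) (fun h => leftAt b h)
  refine Eq.trans h2 (sum_congr rfl fun v hv => ?_)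
  have hm : (multiplicity b v : ℝ) ≠ 0 := by
    obtain ⟨h, -, rfl⟩ := mem_image.1 hv
    exact_mod_cast (card_pos.2 ⟨h, by simp⟩ : 0 < multiplicity b (leftAt b h)).ne'
  rw [nsmul_eq_mul]
  change (multiplicity b v : ℝ) * _ = _
  push_cast
  field_simp

open Classical in
/-- The mixture of the quantile strategies plays to every history with the same probability as the
behavior strategy. -/
theorem sum_quantileCoeff_reaches (hb : ∀ I a, 0 ≤ (b I a).val)
    (hb' : ∀ I, ∑ a, (b I a).val = 1) {h : List ℕ} (hh : h ∈ G.hist) :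
    ∑ k, (quantileCoeff b k).val *
      (if G.Reaches (quantileStrat b (leftAt b k)) h then (1 : ℝ) else 0) =
      ∑ x : G.Pure i, (∏ I, (b I (x I)).val) * (if G.Reaches x h then (1 : ℝ) else 0) := by
  have hD : (totalDen b : ℝ) ≠ 0 := by exact_mod_cast (totalDen_pos b).ne'
  rw [sum_quantileCoeff_mul hb hb' fun x => if G.Reaches x h then (1 : ℝ) else 0,
    sum_reaches_quantileStrat hb hb' hh, sum_prod_mul_reaches hb' hh, width_eq,
    mul_div_cancel_left₀ _ hD]

theorem sum_prod_val (hb' : ∀ I, ∑ a, (b I a).val = 1) :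
    ∑ x : G.Pure i, (∏ I, (b I (x I)).val) = 1 := by
  rw [← Fintype.prod_sum (fun (I : G.infosets i) (c : G.infosetActions i (I : ℕ)) => (b I c).val)]
  simp only [hb', prod_const_one]

theorem sum_quantileCoeff (hb : ∀ I a, 0 ≤ (b I a).val) (hb' : ∀ I, ∑ a, (b I a).val = 1) :
    ∑ k, (quantileCoeff b k).val = 1 := by
  classical
  have := sum_quantileCoeff_reaches hb hb' G.root_mem
  simpa only [G.reaches_nil, if_true, mul_one, sum_prod_val hb'] using this

/-- Every behavior strategy of the mixture, replaced by the mixture of its quantile strategies. -/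
noncomputable def BehavioralMixture.quantileMixture {T : ℕ} (π : G.BehavioralMixture T) :
    G.SmallSupportMixture T G.hist.card where
  weight := π.weight
  weight_nonneg := π.weight_nonneg
  weight_sum := π.weight_sum
  coeff t i k := quantileCoeff (π.prob t i) (G.hist.orderIsoOfFin rfl k)
  coeff_nonneg t i k := quantileCoeff_nonneg (π.prob_nonneg t i) (π.prob_sum t i) _
  coeff_sum t i := by
    rw [← sum_quantileCoeff (π.prob_nonneg t i) (π.prob_sum t i)]
    exact (G.hist.orderIsoOfFin rfl).toEquiv.sum_comp fun h => (quantileCoeff (π.prob t i) h).val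
  strat t i k := quantileStrat (π.prob t i) (leftAt (π.prob t i) (G.hist.orderIsoOfFin rfl k))

open Classical in
theorem BehavioralMixture.sum_quantileMixture_reaches {T : ℕ} (π : G.BehavioralMixture T)
    (t : Fin T) (j : Fin n) {h : List ℕ} (hh : h ∈ G.hist) :
    ∑ x : G.Pure j, (∏ I, (π.prob t j I (x I)).val) * (if G.Reaches x h then (1 : ℝ) else 0) =
      ∑ x : G.Pure j, (∑ k, (π.quantileMixture.coeff t j k).val *
        if π.quantileMixture.strat t j k = x then 1 else 0) *
          (if G.Reaches x h then (1 : ℝ) else 0) := by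
  rw [← sum_quantileCoeff_reaches (π.prob_nonneg t j) (π.prob_sum t j) hh,
    ← (G.hist.orderIsoOfFin rfl).toEquiv.sum_comp]
  simp only [Finset.sum_mul]
  rw [sum_comm]
  refine sum_congr rfl fun k _ => ?_
  simp only [mul_assoc, ← mul_sum, ite_mul, one_mul, zero_mul, sum_ite_eq, mem_univ, if_true]
  rfl

theorem BehavioralMixture.outcomeEquivalent_quantileMixture {T : ℕ} (π : G.BehavioralMixture T) :
    G.OutcomeEquivalent π.dist π.quantileMixture.dist := by
  classical
  refine G.outcomeEquivalent_mixture _ fun t j h hh => ?_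
  convert π.sum_quantileMixture_reaches t j hh

theorem BehavioralMixture.isEFCE_quantileMixture {T : ℕ} (π : G.BehavioralMixture T) {ε : ℝ}
    (hπ : G.IsEFCE ε π.dist) : G.IsEFCE ε π.quantileMixture.dist := by
  classical
  refine ⟨G.mixture_mem_stdSimplex π.weight_nonneg π.weight_sum (fun t j x => ?_) fun t j => ?_,
    fun i φ hφ => ?_⟩
  · refine sum_nonneg fun k _ => mul_nonneg (π.quantileMixture.coeff_nonneg t j k) ?_
    split_ifs
    · exact zero_le_one
    · exact le_rfl
  · rw [sum_comm]
    simpa using π.quantileMixture.coeff_sum t j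
  · refine le_of_eq_of_le (Eq.symm ?_) (hπ.2 i φ hφ)
    refine G.regret_mixture _ (fun t j h hh => ?_) hφ
    convert π.sum_quantileMixture_reaches t j hh

theorem BehavioralMixture.encode_quantileMixture {T : ℕ} (π : G.BehavioralMixture T) :
    π.quantileMixture.encode = Val.ofFamily fun t : Fin T => .cons (π.weight t).encode
      (Val.ofFamily fun i : Fin n => Val.ofFamily fun h : G.hist =>
        .cons (quantileCoeff (π.prob t i) h).encode (Val.ofFamily fun I : G.infosets i =>
          .cons (Val.ofNat I)
            (Val.ofNat (quantileStrat (π.prob t i) (leftAt (π.prob t i) h) I)))) := by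
  rw [SmallSupportMixture.encode]
  congr! 5 with t i
  exact Val.ofFamily_orderIso (G.hist.orderIsoOfFin rfl) fun h : G.hist =>
    .cons (quantileCoeff (π.prob t i) h).encode (Val.ofFamily fun I : G.infosets i =>
      .cons (Val.ofNat I) (Val.ofNat (quantileStrat (π.prob t i) (leftAt (π.prob t i) h) I)))

end Game

namespace PolyDec

variable {X : Type*} {e : X → Val} {c d : X → Prop}

theorem or (hc : PolyDec e c) (hd : PolyDec e d) : PolyDec e fun x => c x ∨ d x :=
  (hc.not.and' hd.not).not.congr fun x => by tauto

theorem comp {Y : Type*} {e' : Y → Val} {c : Y → Prop} (r : X → Y)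
    (hr : PolyTime e fun x => e' (r x)) (hc : PolyDec e' c) : PolyDec e fun x => c (r x) :=
  PolyTime.comp r hr hc

theorem false : PolyDec e fun _ => False :=
  (PolyTime.const (Val.ofBool Bool.false)).congr fun x => by simp

end PolyDec

namespace PolyTime

variable {X : Type*} {e : X → Val}

theorem int_ite {c : X → Prop} [DecidablePred c] {f g : X → ℤ} (hc : PolyDec e c)
    (hf : PolyTime e fun x => .int (f x)) (hg : PolyTime e fun x => .int (g x)) :
    PolyTime e fun x => .int (if c x then f x else g x) :=
  (ite hc (F := fun x => .int (f x)) (F' := fun x => .int (g x)) (hf.restrict Subtype.val)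
    (hg.restrict Subtype.val)).congr fun x => by split_ifs <;> rfl

end PolyTime

/-- What remains of the history `h` after its initial segment `g`; an integer if `g` is not an
initial segment of `h`. -/
def stripPrefix (h g : List ℕ) : Val :=
  g.foldl (fun s a => if s.hd = Val.ofNat a then s.tl else .int 0) (Game.encodeHistory h)

theorem hd_stripPrefix (h g : List ℕ) (b : ℕ) :
    (stripPrefix h g).hd = Val.ofNat b ↔ g ++ [b] <+: h := by
  have hfail : ∀ g : List ℕ,
      (g.foldl (fun s a => if s.hd = Val.ofNat a then s.tl else .int 0) (Val.int 0)) = .int 0 := by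
    intro g
    induction g with
    | nil => rfl
    | cons a g ih => rw [List.foldl_cons, if_neg (by simp [Val.hd, Val.ofNat]), ih]
  induction g generalizing h with
  | nil =>
    cases h with
    | nil => simp [stripPrefix, Game.encodeHistory, Val.hd, Val.ofNat]
    | cons c h => simp [stripPrefix, Game.encodeHistory, Val.hd, Val.ofNat, eq_comm]
  | cons a g ih =>
    cases h with
    | nil =>
      rw [stripPrefix, List.foldl_cons, if_neg (by simp [Game.encodeHistory, Val.hd, Val.ofNat]),
        hfail]
      simp [Val.hd, Val.ofNat]
    | cons c h =>
      by_cases hc : c = a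
      · subst hc
        rw [stripPrefix, List.foldl_cons, if_pos (by simp [Game.encodeHistory, Val.hd]),
          List.cons_append, List.cons_prefix_cons, and_iff_right rfl]
        exact ih h
      · rw [stripPrefix, List.foldl_cons, if_neg (by
          simpa [Game.encodeHistory, Val.hd, Val.ofNat] using hc), hfail]
        simp [Val.hd, Val.ofNat, Ne.symm hc]

theorem PolyTime.stripPrefix {X : Type*} {e : X → Val} {h g : X → List ℕ}
    (hh : PolyTime e fun x => Game.encodeHistory (h x))
    (hg : PolyTime e fun x => Game.encodeHistory (g x)) :
    PolyTime e fun x => stripPrefix (h x) (g x) := by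
  refine foldl_of_growth (α := fun _ => ℕ) (enc := fun _ a => Val.ofNat a)
    (step := fun _ s a => if s.hd = Val.ofNat a then s.tl else .int 0) hg hh ?_
    ⟨0, fun x s a => ?_⟩
  · have h1 : PolyTime (stepEnv e fun (_ : X) (a : ℕ) => Val.ofNat a) fun p => p.2.1 := state
    have h2 : PolyTime (stepEnv e fun (_ : X) (a : ℕ) => Val.ofNat a) fun p => Val.ofNat p.2.2 :=
      toStep top
    exact ite (c := fun p : Σ _ : X, Val × ℕ => p.2.1.hd = Val.ofNat p.2.2)
      (F := fun p => p.2.1.tl) (F' := fun _ => .int 0) (PolyDec.eq h1.hd h2)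
      (h1.tl.restrict Subtype.val) (const _)
  · have := s.size_tl_le
    have := s.one_le_size
    split_ifs
    · simpa
    · simpa [Val.size]

theorem PolyDec.isPrefix {X : Type*} {e : X → Val} {h g : X → List ℕ} {a : X → ℕ}
    (hh : PolyTime e fun x => Game.encodeHistory (h x))
    (hg : PolyTime e fun x => Game.encodeHistory (g x)) (ha : PolyTime e fun x => .ofNat (a x)) :
    PolyDec e fun x => g x ++ [a x] <+: h x :=
  (PolyDec.eq (PolyTime.stripPrefix hh hg).hd ha).congr fun _ => hd_stripPrefix _ _ _

theorem PolyDec.nat_eq {X : Type*} {e : X → Val} {a b : X → ℕ}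
    (ha : PolyTime e fun x => .ofNat (a x)) (hb : PolyTime e fun x => .ofNat (b x)) :
    PolyDec e fun x => a x = b x :=
  (PolyDec.eq ha hb).congr fun _ => Val.ofNat_injective.eq_iff

theorem PolyDec.nat_lt {X : Type*} {e : X → Val} {a b : X → ℕ}
    (ha : PolyTime e fun x => .ofNat (a x)) (hb : PolyTime e fun x => .ofNat (b x)) :
    PolyDec e fun x => a x < b x :=
  (PolyDec.lt ha hb).congr fun _ => Int.ofNat_lt

/-- Membership in the set `S x` of pairs is decided from the pair and `e x` in polynomial time. -/
def PolySet {X : Type*} (e : X → Val) (S : X → Set (ℕ × ℕ)) : Prop :=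
  PolyDec (fun p : X × ℕ × ℕ => .cons (.cons (.ofNat p.2.1) (.ofNat p.2.2)) (e p.1))
    fun p => p.2 ∈ S p.1

theorem PolySet.mem {X : Type*} {e : X → Val} {S : X → Set (ℕ × ℕ)} (hS : PolySet e S)
    {Y : Type*} {e' : Y → Val} (r : Y → X) (hr : PolyTime e' fun y => e (r y)) {J a : Y → ℕ}
    (hJ : PolyTime e' fun y => .ofNat (J y)) (ha : PolyTime e' fun y => .ofNat (a y)) :
    PolyDec e' fun y => (J y, a y) ∈ S (r y) :=
  PolyDec.comp (fun y => (r y, J y, a y)) ((hJ.pair ha).pair hr) hS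

/-- A game, one of its players, and action probabilities for this player. -/
structure PlayerInput where
  n : ℕ
  G : Game n
  i : Fin n
  b : G.ActionProbs i

namespace PlayerInput

/-- Encoding of an action at an information set with its probability. -/
def encodeAction (r : PlayerInput) (I : r.G.infosets r.i) (a : r.G.infosetActions r.i (I : ℕ)) :
    Val := .cons (.ofNat a) (r.b I a).encode

/-- Encoding of an information set with the action probabilities. -/
def encodeInfoset (r : PlayerInput) (I : r.G.infosets r.i) : Val :=
  .cons (.ofNat I) (.ofFamily (r.encodeAction I))

/-- Encoding of a player with its game and action probabilities. -/
def encode (r : PlayerInput) : Val :=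
  .cons (.ofNat r.i) (.cons (.ofFamily r.encodeInfoset) r.G.encode)

variable {X : Type*} {e : X → Val} {r : X → PlayerInput}

/-- The environment extended by a node of the game. -/
abbrev nodeEnv (e : X → Val) (r : X → PlayerInput) : (Σ x, (r x).G.hist) → Val :=
  PolyTime.ext e fun x (h : (r x).G.hist) => (r x).G.encodeNode h

/-- The environment extended by an information set. -/
abbrev infosetEnv (e : X → Val) (r : X → PlayerInput) : (Σ x, (r x).G.infosets (r x).i) → Val :=
  PolyTime.ext e fun x I => (r x).encodeInfoset I

/-- The environment extended by an information set and an action. -/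
abbrev actionEnv (e : X → Val) (r : X → PlayerInput) :
    (Σ p : Σ x, (r x).G.infosets (r x).i, (r p.1).G.infosetActions (r p.1).i (p.2 : ℕ)) → Val :=
  PolyTime.ext (infosetEnv e r) fun p a => (r p.1).encodeAction p.2 a

theorem polyTime_nodes (hr : PolyTime e fun x => (r x).encode) :
    PolyTime e fun x => .ofFamily fun h : (r x).G.hist => (r x).G.encodeNode h := hr.tl.tl

theorem polyTime_infosets (hr : PolyTime e fun x => (r x).encode) :
    PolyTime e fun x => .ofFamily (r x).encodeInfoset := hr.tl.hd

theorem polyTime_actions :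
    PolyTime (infosetEnv e r) fun p => .ofFamily ((r p.1).encodeAction p.2) :=
  (PolyTime.top (e := e) (enc := fun x I => (r x).encodeInfoset I)).tl

theorem polyTime_infoset : PolyTime (infosetEnv e r) fun p => .ofNat p.2 :=
  (PolyTime.top (e := e) (enc := fun x I => (r x).encodeInfoset I)).hd

theorem polyTime_action : PolyTime (actionEnv e r) fun p => .ofNat p.2 :=
  (PolyTime.top (e := infosetEnv e r) (enc := fun p a => (r p.1).encodeAction p.2 a)).hd

theorem polyTime_history : PolyTime (nodeEnv e r) fun p => Game.encodeHistory p.2 :=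
  (PolyTime.top (e := e) (enc := fun x (h : (r x).G.hist) => (r x).G.encodeNode h)).hd

theorem polyDec_mem_infosetNodes (hr : PolyTime e fun x => (r x).encode)
    {g : ∀ x, (r x).G.hist} (hg : PolyTime e fun x => (r x).G.encodeNode (g x)) {J : X → ℕ}
    (hJ : PolyTime e fun x => .ofNat (J x)) :
    PolyDec e fun x => (g x : List ℕ) ∈ (r x).G.infosetNodes (r x).i (J x) := by
  refine (((PolyDec.eq hg.tl.hd (.const (.int 2))).and' (PolyDec.eq hg.tl.tl.hd hr.hd)).and'
    (PolyDec.eq hg.tl.tl.tl.hd hJ)).congr fun x => ?_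
  rw [Game.mem_infosetNodes, GameForm.nodes, mem_filter, and_iff_right (g x).2]
  by_cases h0 : (r x).G.actions (g x) = ∅
  · simp [Game.encodeNode, h0, Val.hd, Val.tl]
  · rcases ho : (r x).G.owner (g x) with _ | j
    · simp [Game.encodeNode, h0, ho, Val.hd, Val.tl]
    · simp [Game.encodeNode, h0, ho, Val.hd, Val.tl, encode, Val.ofNat_injective.eq_iff, Fin.ext_iff]

theorem polyDec_mem_sequence (hr : PolyTime e fun x => (r x).encode)
    {h : ∀ x, (r x).G.hist} (hh : PolyTime e fun x => Game.encodeHistory (h x)) {J a : X → ℕ}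
    (hJ : PolyTime e fun x => .ofNat (J x)) (ha : PolyTime e fun x => .ofNat (a x)) :
    PolyDec e fun x => (J x, a x) ∈ (r x).G.sequence (r x).i (h x) := by
  refine (PolyDec.exists (c := fun x (g : (r x).G.hist) =>
    (g : List ℕ) ∈ (r x).G.infosetNodes (r x).i (J x) ∧ (g : List ℕ) ++ [a x] <+: h x)
    (polyTime_nodes hr) (PolyDec.and' ?_ ?_)).congr fun x => ?_
  · exact polyDec_mem_infosetNodes (r := fun p : Σ x, (r x).G.hist => r p.1)
      (g := fun p => p.2) hr.weaken .top hJ.weaken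
  · exact PolyDec.isPrefix hh.weaken polyTime_history ha.weaken
  · rw [Game.mem_sequence _ (h x).2]
    constructor
    · rintro ⟨g, h1, h2⟩
      exact ⟨g, h1, h2⟩
    · rintro ⟨g, h1, h2⟩
      exact ⟨⟨g, (r x).G.infosetNodes_subset_hist h1⟩, h1, h2⟩

theorem polySet_pathSet (hr : PolyTime e fun x => (r x).encode)
    {h : ∀ x, (r x).G.hist} (hh : PolyTime e fun x => Game.encodeHistory (h x)) :
    PolySet e fun x => (r x).G.pathSet (r x).i (h x) := by
  have h0 : PolyTime (fun p : X × ℕ × ℕ =>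
    .cons (.cons (.ofNat p.2.1) (.ofNat p.2.2)) (e p.1)) _ := PolyTime.id
  have h1 : PolyTime (fun p : X × ℕ × ℕ =>
    .cons (.cons (.ofNat p.2.1) (.ofNat p.2.2)) (e p.1)) fun p => e p.1 := h0.tl
  exact polyDec_mem_sequence (r := fun p : X × ℕ × ℕ => r p.1) (h := fun p => h p.1)
    (.comp Prod.fst h1 hr) (.comp Prod.fst h1 hh) h0.hd.hd h0.hd.tl

theorem polySet_seqSet (hr : PolyTime e fun x => (r x).encode) {J a : X → ℕ}
    (hJ : PolyTime e fun x => .ofNat (J x)) (ha : PolyTime e fun x => .ofNat (a x)) :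
    PolySet e fun x => (r x).G.seqSet (r x).i (J x) (a x) := by
  have h0 : PolyTime (fun p : X × ℕ × ℕ =>
    .cons (.cons (.ofNat p.2.1) (.ofNat p.2.2)) (e p.1)) _ := PolyTime.id
  have h1 : PolyTime (fun p : X × ℕ × ℕ =>
    .cons (.cons (.ofNat p.2.1) (.ofNat p.2.2)) (e p.1)) fun p => e p.1 := h0.tl
  have hr' := PolyTime.comp Prod.fst h1 hr
  have hJ' := PolyTime.comp Prod.fst h1 hJ
  have ha' := PolyTime.comp Prod.fst h1 ha
  have h2 := PolyDec.exists (c := fun (p : X × ℕ × ℕ) (g : (r p.1).G.hist) =>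
    (g : List ℕ) ∈ (r p.1).G.infosetNodes (r p.1).i (J p.1) ∧
      (p.2.1, p.2.2) ∈ (r p.1).G.sequence (r p.1).i g) (polyTime_nodes hr')
    ((polyDec_mem_infosetNodes (r := fun q : Σ p : X × ℕ × ℕ, (r p.1).G.hist => r q.1.1)
      (g := fun q => q.2) hr'.weaken .top hJ'.weaken).and'
    (polyDec_mem_sequence (r := fun q : Σ p : X × ℕ × ℕ, (r p.1).G.hist => r q.1.1)
      (h := fun q => q.2) hr'.weaken
      (polyTime_history (r := fun p : X × ℕ × ℕ => r p.1)) h0.hd.hd.weaken h0.hd.tl.weaken))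
  refine (((PolyDec.nat_eq h0.hd.hd hJ').and' (PolyDec.nat_eq h0.hd.tl ha')).or h2).congr
    fun p => ?_
  refine or_congr (Prod.ext_iff (y := (J p.1, a p.1))).symm ⟨?_, ?_⟩
  · rintro ⟨g, h1, h2⟩
    exact ⟨g, h1, h2⟩
  · rintro ⟨g, h1, h2⟩
    exact ⟨⟨g, (r p.1).G.infosetNodes_subset_hist h1⟩, h1, h2⟩

theorem polyTime_width (hr : PolyTime e fun x => (r x).encode) {S : X → Set (ℕ × ℕ)}
    (hS : PolySet e S) : PolyTime e fun x => .int (Game.width (r x).b (S x)) := by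
  classical
  refine PolyTime.fintype_prod (polyTime_infosets hr) (PolyTime.fintype_prod polyTime_actions ?_)
  have h0 : PolyTime (actionEnv e r) _ := PolyTime.id
  exact PolyTime.int_ite (hS.mem (fun p => p.1.1) h0.tl.tl polyTime_infoset.weaken polyTime_action)
    h0.hd.tl.hd h0.hd.tl.tl

/-- The environment extended by an information set and two actions. -/
abbrev actionPairEnv (e : X → Val) (r : X → PlayerInput) :
    (Σ p : Σ p : Σ x, (r x).G.infosets (r x).i, (r p.1).G.infosetActions (r p.1).i (p.2 : ℕ),
      (r p.1.1).G.infosetActions (r p.1.1).i (p.1.2 : ℕ)) → Val :=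
  PolyTime.ext (actionEnv e r) fun p a => (r p.1.1).encodeAction p.1.2 a

theorem polyTime_left (hr : PolyTime e fun x => (r x).encode) {S : X → Set (ℕ × ℕ)}
    (hS : PolySet e S) : PolyTime e fun x => .int (Game.left (r x).b (S x)) := by
  classical
  refine PolyTime.fintype_sum (polyTime_infosets hr) (PolyTime.fintype_sum polyTime_actions
    (PolyTime.fintype_sum polyTime_actions.weaken ?_))
  have h0 : PolyTime (actionPairEnv e r) (actionPairEnv e r) := PolyTime.id
  have ha' : PolyTime (actionPairEnv e r) fun p => .ofNat p.2 := h0.hd.hd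
  have ha : PolyTime (actionPairEnv e r) fun p => .ofNat p.1.2 := h0.tl.hd.hd
  have hJ : PolyTime (actionPairEnv e r) fun p => .ofNat p.1.1.2 := h0.tl.tl.hd.hd
  have he : PolyTime (actionPairEnv e r) fun p => e p.1.1.1 := h0.tl.tl.tl
  have hr' : PolyTime (actionPairEnv e r) fun p => (r p.1.1.1).encode :=
    hr.weaken.weaken.weaken
  refine PolyTime.int_ite (e := actionPairEnv e r) (PolyDec.and' (PolyDec.nat_lt ha' ha)
    (hS.mem (fun p => p.1.1.1) he hJ ha)) ?_ (.const _)
  exact polyTime_width hr' (polySet_seqSet hr' hJ ha')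

theorem polyTime_leftAt (hr : PolyTime e fun x => (r x).encode) {h : ∀ x, (r x).G.hist}
    (hh : PolyTime e fun x => Game.encodeHistory (h x)) :
    PolyTime e fun x => .int (Game.leftAt (r x).b (h x)) :=
  polyTime_left hr (polySet_pathSet hr hh)

theorem polyTime_totalDen (hr : PolyTime e fun x => (r x).encode) :
    PolyTime e fun x => .ofNat (Game.totalDen (r x).b) :=
  (polyTime_width hr (S := fun _ => ∅) PolyDec.false).congr fun x => by
    rw [Game.width_empty]; rfl

theorem polyTime_nextLeft (hr : PolyTime e fun x => (r x).encode) {v : X → ℤ}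
    (hv : PolyTime e fun x => .int (v x)) :
    PolyTime e fun x => .int (Game.nextLeft (r x).b (v x)) := by
  classical
  have hleft : PolyTime (nodeEnv e r) fun p => .int (Game.leftAt (r p.1).b p.2) :=
    polyTime_leftAt (r := fun p : Σ x, (r x).G.hist => r p.1) (h := fun p => p.2) hr.weaken
      polyTime_history
  have hnext : PolyDec (nodeEnv e r) fun p => Game.IsNext (r p.1).b (v p.1) p.2 := by
    refine (PolyDec.lt hv.weaken hleft).and' (PolyDec.not (PolyDec.exists
      (polyTime_nodes hr.weaken) (PolyDec.and' ?_ ?_)))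
    · exact PolyDec.lt hv.weaken.weaken (polyTime_leftAt
        (r := fun q : Σ p : Σ x, (r x).G.hist, (r p.1).G.hist => r q.1.1) (h := fun q => q.2)
        hr.weaken.weaken (polyTime_history (r := fun p : Σ x, (r x).G.hist => r p.1)))
    · exact PolyDec.lt (polyTime_leftAt
        (r := fun q : Σ p : Σ x, (r x).G.hist, (r p.1).G.hist => r q.1.1) (h := fun q => q.2)
        hr.weaken.weaken (polyTime_history (r := fun p : Σ x, (r x).G.hist => r p.1))) hleft.weaken
  have h := PolyTime.foldl_select (c := fun x (h : (r x).G.hist) => Game.IsNext (r x).b (v x) h)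
    (v := fun x h => .int (Game.leftAt (r x).b h)) (polyTime_nodes hr) (polyTime_totalDen hr)
    hnext hleft
  refine h.congr fun x => ?_
  exact List.foldl_hom Val.int (fun s a => by split_ifs <;> rfl)

theorem polyTime_multiplicity (hr : PolyTime e fun x => (r x).encode) {v : X → ℤ}
    (hv : PolyTime e fun x => .int (v x)) :
    PolyTime e fun x => .ofNat (Game.multiplicity (r x).b (v x)) := by
  classical
  have hleft : PolyTime (nodeEnv e r) fun p => .int (Game.leftAt (r p.1).b p.2) :=
    polyTime_leftAt (r := fun p : Σ x, (r x).G.hist => r p.1) (h := fun p => p.2) hr.weaken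
      polyTime_history
  refine (PolyTime.fintype_sum
    (f := fun x (h : (r x).G.hist) => if Val.int (Game.leftAt (r x).b h) = .int (v x) then 1 else 0)
    (polyTime_nodes hr) (PolyTime.int_ite (PolyDec.eq hleft hv.weaken)
    (.const (.int 1)) (.const (.int 0)))).congr fun x => ?_
  simp [Game.multiplicity, Val.ofNat]

theorem polyTime_quantileStrat (hr : PolyTime e fun x => (r x).encode) {u : X → ℤ}
    (hu : PolyTime e fun x => .int (u x)) : PolyTime (infosetEnv e r) fun p =>
      .ofNat (Game.quantileStrat (r p.1).b (u p.1) p.2) := by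
  classical
  have h0 : PolyTime (actionEnv e r) (actionEnv e r) := PolyTime.id
  have ha : PolyTime (actionEnv e r) fun p => .ofNat p.2 := h0.hd.hd
  have hJ : PolyTime (actionEnv e r) fun p => .ofNat p.1.2 := h0.tl.hd.hd
  have hr' : PolyTime (actionEnv e r) fun p => (r p.1.1).encode := hr.weaken.weaken
  have hu' : PolyTime (actionEnv e r) fun p => .int (u p.1.1) := hu.weaken.weaken
  have hle : PolyDec (actionEnv e r) fun p =>
      Game.left (r p.1.1).b ((r p.1.1).G.seqSet (r p.1.1).i p.1.2 p.2) ≤ u p.1.1 :=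
    ((PolyDec.lt hu' (polyTime_left hr' (polySet_seqSet hr' hJ ha))).not).congr fun p => not_lt
  have h := PolyTime.foldl_select
    (c := fun (p : Σ x, (r x).G.infosets (r x).i)
      (a : (r p.1).G.infosetActions (r p.1).i (p.2 : ℕ)) =>
      Game.left (r p.1).b ((r p.1).G.seqSet (r p.1).i p.2 a) ≤ u p.1)
    (v := fun p (a : (r p.1).G.infosetActions (r p.1).i (p.2 : ℕ)) => .ofNat a)
    polyTime_actions (polyTime_actions (e := e) (r := r)).hd.hd hle polyTime_action
  refine h.congr fun p => ?_
  have hinit : (Val.ofFamily ((r p.1).encodeAction p.2)).hd.hd =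
      .ofNat (((univ : Finset ((r p.1).G.infosetActions (r p.1).i (p.2 : ℕ))).sort (· ≤ ·)).head
        (Game.sort_infosetActions_ne_nil p.2)) := by
    have key : ∀ (l : List ((r p.1).G.infosetActions (r p.1).i (p.2 : ℕ))) (hne : l ≠ []),
        (Val.ofList (l.map ((r p.1).encodeAction p.2))).hd.hd = .ofNat (l.head hne) := by
      intro l hne
      cases l with
      | nil => exact absurd rfl hne
      | cons a l => rfl
    exact key _ _
  rw [hinit]
  exact List.foldl_hom (fun a : (r p.1).G.infosetActions (r p.1).i (p.2 : ℕ) => Val.ofNat a)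
    (fun s a => by split_ifs <;> rfl)

theorem polyTime_quantileFamily (hr : PolyTime e fun x => (r x).encode) :
    PolyTime e fun x => .ofFamily fun h : (r x).G.hist =>
      .cons (Game.quantileCoeff (r x).b h).encode (.ofFamily fun I : (r x).G.infosets (r x).i =>
        .cons (.ofNat I) (.ofNat (Game.quantileStrat (r x).b (Game.leftAt (r x).b h) I))) := by
  have hr' : PolyTime (nodeEnv e r) fun p => (r p.1).encode := hr.weaken
  have hleft : PolyTime (nodeEnv e r) fun p => .int (Game.leftAt (r p.1).b p.2) :=
    polyTime_leftAt (r := fun p : Σ x, (r x).G.hist => r p.1) (h := fun p => p.2) hr'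
      polyTime_history
  refine PolyTime.family (polyTime_nodes hr) (PolyTime.pair (PolyTime.pair ?_ ?_) ?_)
  · exact (polyTime_nextLeft hr' hleft).sub hleft
  · exact ((polyTime_totalDen hr').mul (polyTime_multiplicity hr' hleft)).congr fun x => by
      simp [Val.ofNat, Game.quantileCoeff]
  · exact PolyTime.family (polyTime_infosets hr') (polyTime_infoset.pair
      (polyTime_quantileStrat hr' hleft))

end PlayerInput

/-- A game with a mixture of products of behavior strategies. -/
structure MixtureInput where
  n : ℕ
  T : ℕ
  G : Game n
  π : G.BehavioralMixture T

theorem polyTime_quantileMixture :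
    PolyTime (fun x : MixtureInput => x.π.encodeInput) fun x => x.π.quantileMixture.encode := by
  have h0 := PolyTime.id (e := fun x : MixtureInput => x.π.encodeInput)
  refine PolyTime.congr ?_ fun x => x.π.encode_quantileMixture.symm
  have h1 : PolyTime (fun x : MixtureInput => x.π.encodeInput) fun x =>
      .ofFamily fun t : Fin x.T => .cons (x.π.weight t).encode
    (Val.ofFamily fun i : Fin x.n => Val.ofFamily fun I : x.G.infosets i =>
      .cons (Val.ofNat I) (Val.ofFamily fun a : x.G.infosetActions i (I : ℕ) =>
        .cons (Val.ofNat a) (x.π.prob t i I a).encode)) := h0.tl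
  refine PolyTime.family h1 (PolyTime.top.hd.pair ?_)
  have h2 := PolyTime.indexed (PolyTime.top (e := fun x : MixtureInput => x.π.encodeInput)
    (enc := fun x (t : Fin x.T) => .cons (x.π.weight t).encode
    (Val.ofFamily fun i : Fin x.n => Val.ofFamily fun I : x.G.infosets i =>
      .cons (Val.ofNat I) (Val.ofFamily fun a : x.G.infosetActions i (I : ℕ) =>
        .cons (Val.ofNat a) (x.π.prob t i I a).encode)))).tl
  refine PolyTime.family h2 ?_
  refine PlayerInput.polyTime_quantileFamily
    (r := fun p : Σ p : Σ x : MixtureInput, Fin x.T, Fin p.1.n =>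
      ⟨p.1.1.n, p.1.1.G, p.2, p.1.1.π.prob p.1.2 p.2⟩) ?_
  exact PolyTime.top.hd.pair (PolyTime.top.tl.pair h0.hd.weaken.weaken)

namespace Val

/-- The number of atoms of a value. -/
def leaves : Val → ℕ
  | cons a b => a.leaves + b.leaves
  | _ => 1

theorem size_lt_leaves_mul (v : Val) : v.size + 1 ≤ v.leaves * (v.maxBits + 2) := by
  induction v with
  | int z => simp only [size, leaves, maxBits]; omega
  | nil => simp [size, leaves, maxBits]
  | cons a b iha ihb =>
    simp only [size, leaves, maxBits]
    have h1 := Nat.mul_le_mul_left a.leaves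
      (Nat.add_le_add_right (le_max_left a.maxBits b.maxBits) 2)
    have h2 := Nat.mul_le_mul_left b.leaves
      (Nat.add_le_add_right (le_max_right a.maxBits b.maxBits) 2)
    rw [add_mul]
    omega

theorem leaves_ofList_le {M : ℕ} (l : List Val) (h : ∀ v ∈ l, v.leaves ≤ M) :
    (ofList l).leaves ≤ 1 + l.length * M := by
  induction l with
  | nil => simp [leaves]
  | cons v l ih =>
    have h1 := h v (by simp)
    have h2 := ih fun w hw => h w (by simp [hw])
    simp only [ofList_cons, leaves, List.length_cons, add_mul]
    omega

theorem leaves_ofFamily_le {α : Type} [Fintype α] [LinearOrder α] {f : α → Val} {C M : ℕ}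
    (hC : Fintype.card α ≤ C) (h : ∀ a, (f a).leaves ≤ M) : (ofFamily f).leaves ≤ 1 + C * M := by
  refine (leaves_ofList_le (M := M) _ ?_).trans ?_
  · intro v hv
    obtain ⟨a, -, rfl⟩ := List.mem_map.1 hv
    exact h a
  · rw [List.length_map, Finset.length_sort]
    exact Nat.add_le_add_left (Nat.mul_le_mul_right _ hC) _

@[simp] theorem leaves_ofNat (m : ℕ) : (ofNat m).leaves = 1 := rfl

end Val

namespace Game

variable {n : ℕ} (G : Game n)

theorem length_lt_card_hist {h : List ℕ} (hh : h ∈ G.hist) : h.length < G.hist.card := by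
  have hinj : Set.InjOn (fun k => h.take k) (range (h.length + 1)) := by
    intro k hk k' hk' e
    have := congrArg List.length e
    simp only [coe_range, Set.mem_Iio, List.length_take] at *
    omega
  have := card_le_card_of_injOn (t := G.hist) _
    (fun k _ => G.mem_hist_of_prefix (List.take_prefix k h) hh) hinj
  rw [card_range] at this
  omega

theorem card_actions_le (h : List ℕ) : (G.actions h).card ≤ G.hist.card :=
  card_le_card_of_injOn (fun a => h ++ [a]) (fun a ha => (G.mem_actions h a).1 ha)
    fun a _ a' _ e => by simpa using e

theorem card_infosets_le (i : Fin n) : (G.infosets i).card ≤ G.hist.card :=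
  card_image_le.trans (card_filter_le _ _)

theorem card_infosetActions_le {i : Fin n} (I : G.infosets i) :
    (G.infosetActions i (I : ℕ)).card ≤ G.hist.card := by
  obtain ⟨g, hg⟩ := G.exists_infosetNode I
  rw [G.infosetActions_eq hg]
  exact G.card_actions_le g

theorem leaves_encodeHistory_le {h : List ℕ} (hh : h ∈ G.hist) :
    (encodeHistory h).leaves ≤ 1 + G.hist.card := by
  have h1 := Val.leaves_ofList_le (M := 1) (h.map Val.ofNat) (by simp)
  have h2 := G.length_lt_card_hist hh
  simp only [List.length_map, encodeHistory] at *
  omega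

theorem leaves_encodeNode_le {h : List ℕ} (hh : h ∈ G.hist) :
    (G.encodeNode h).leaves ≤ 5 + 4 * G.hist.card + 2 * n := by
  have h0 := G.leaves_encodeHistory_le hh
  rw [encodeNode, Val.leaves]
  split_ifs
  · have := Val.leaves_ofFamily_le (f := fun i : Fin n => (G.util i h).encode) (M := 2)
      (Fintype.card_fin n).le fun i => le_rfl
    simp only [Val.leaves]
    omega
  · split
    · have := Val.leaves_ofFamily_le (M := 3) (C := G.hist.card) (f := fun a : G.actions h =>
          Val.cons (Val.ofNat a) (G.chanceProb h a).encode)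
        (by rw [Fintype.card_coe]; exact G.card_actions_le h) fun a => le_rfl
      simp only [Val.leaves]
      omega
    · have := Val.leaves_ofFamily_le (M := 1) (C := G.hist.card)
        (f := fun a : G.actions h => Val.ofNat a)
        (by rw [Fintype.card_coe]; exact G.card_actions_le h) fun a => le_rfl
      simp only [Val.leaves, Val.leaves_ofNat]
      omega

theorem leaves_encode_le :
    G.encode.leaves ≤ 1 + G.hist.card * (5 + 4 * G.hist.card + 2 * n) :=
  Val.leaves_ofFamily_le (Fintype.card_coe _).le fun h => G.leaves_encodeNode_le h.2

variable {G}

theorem BehavioralMixture.leaves_encode_le {T : ℕ} (π : G.BehavioralMixture T) :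
    π.encode.leaves ≤
      1 + T * (2 + (1 + n * (1 + G.hist.card * (1 + (1 + G.hist.card * 3))))) := by
  refine Val.leaves_ofFamily_le (Fintype.card_fin T).le fun t => Nat.add_le_add_left ?_ 2
  refine Val.leaves_ofFamily_le (Fintype.card_fin n).le fun i => ?_
  refine Val.leaves_ofFamily_le (by rw [Fintype.card_coe]; exact G.card_infosets_le i) fun I =>
    Nat.add_le_add_left ?_ 1
  exact Val.leaves_ofFamily_le (by rw [Fintype.card_coe]; exact G.card_infosetActions_le I)
    fun a => le_rfl

theorem BehavioralMixture.exists_size_encodeInput_le (q : Polynomial ℕ) :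
    ∃ s : Polynomial ℕ, ∀ (n T : ℕ) (G : Game n) (π : G.BehavioralMixture T),
      n ≤ q.eval (G.hist.card + T) → π.encodeInput.maxBits ≤ q.eval (G.hist.card + T) →
        π.encodeInput.size ≤ s.eval (G.hist.card + T) := by
  refine ⟨(1 + .X * (5 + 4 * .X + 2 * q) +
    (1 + .X * (2 + (1 + q * (1 + .X * (1 + (1 + .X * 3))))))) *
    (q + 2), fun n T G π hn hbits => ?_⟩
  simp only [Polynomial.eval_mul, Polynomial.eval_add, Polynomial.eval_one, Polynomial.eval_X,
    Polynomial.eval_ofNat]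
  set N := G.hist.card + T with hN
  have hH : G.hist.card ≤ N := by omega
  have hT : T ≤ N := by omega
  have h0 := π.encodeInput.size_lt_leaves_mul
  refine (Nat.le_of_succ_le h0).trans (Nat.mul_le_mul (Nat.add_le_add
    (G.leaves_encode_le.trans ?_) (π.leaves_encode_le.trans ?_)) (by omega))
  · gcongr
  · gcongr

end Game

theorem mainTheorem4 :
    ∃ conv : Prog, ∀ q : Polynomial ℕ, ∃ p : Polynomial ℕ,
      ∀ (n T : ℕ) (G : Game n) (π : G.BehavioralMixture T) (ε : ℝ),
        n ≤ q.eval (G.hist.card + T) →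
        π.encodeInput.maxBits ≤ q.eval (G.hist.card + T) →
        G.IsEFCE ε π.dist →
        ∃ (K time : ℕ) (π' : G.SmallSupportMixture T K),
          conv.Run π.encodeInput π'.encode time ∧
          time ≤ p.eval (G.hist.card + T) ∧
          0 < K ∧ K ≤ G.hist.card ∧
          G.OutcomeEquivalent π.dist π'.dist ∧
          G.IsEFCE ε π'.dist := by
  obtain ⟨conv, p, hconv⟩ := polyTime_quantileMixture
  refine ⟨conv, fun q => ?_⟩
  obtain ⟨s, hs⟩ := Game.BehavioralMixture.exists_size_encodeInput_le q
  refine ⟨p.comp s, fun n T G π ε hn hbits hπ => ?_⟩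
  obtain ⟨t, ht, ht'⟩ := hconv ⟨n, T, G, π⟩
  refine ⟨G.hist.card, t, π.quantileMixture, ht, ?_, card_pos.2 ⟨[], G.root_mem⟩, le_rfl,
    π.outcomeEquivalent_quantileMixture, π.isEFCE_quantileMixture hπ⟩
  rw [Polynomial.eval_comp]
  exact ht'.trans (p.eval_monotone_nat (hs n T G π hn hbits))
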